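/- **Theorem (Regret bound with stochastic encoding).** *Setting.* Let $\mathcal G$ be a finite connected graph with at least two nodes and diameter $D=D(\mathcal G)$, let $d\ge 1$, $b\in\mathbb N$, $G>0$, $\nu>0$, $T\in\mathbb N$, and $k=\lfloor b/D\rfloor$; assume $k\ge 3\lceil\log_2 d\rceil+2$. In every round $t=1,\dots,T$ an adversary, who may react to everything that happened before, activates a node $I_t$, which plays $w_t\in\mathbb R^d$; the adversary then chooses a convex loss $\ell_t:\mathbb R^d\to\mathbb R$ and reveals to $I_t$ a subgradient $g_t\in\partial\ell_t(w_t)$ with $\|g_t\|\le G$ (Euclidean norm). Node $I_t$ encodes $g_t$ with fresh randomness into a code word that decodes to $\hat g_t$. At the end of each round every node sends to its neighbours all code words that it holds and has not sent before, code words being forwarded during at most $D$ rounds. Let $S(t)\subseteq\{1,\dots,t-1\}$ be the set of $s$ for which $\hat g_s$ is available at $I_t$ when it plays in round $t$; put $\gamma(t)=\{1,\dots,t-1\}\setminus S(t)$ and $\gamma_t(s)=\gamma(s)\cap S(t)$. *Encoding (sparsified quantization).* Let $p=\lceil\log_2 d\rceil$ and $m=\lfloor k/(3\lceil\log_2 d\rceil+2)\rfloor$.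 For $x$ in the ball of radius $G$, draw $m$ independent uniform coordinates $i_1,\dots,i_m\in\{1,\dots,d\}$ and set $\hat x=\frac1m\sum_{j=1}^m d\,\tilde x^{(j)}e_{i_j}$, where $\tilde x^{(j)}=\operatorname{sign}(x_{i_j})\,2^{-p}G\,\big(q_j+\beta_j\big)$ with $q_j=\min\{\lfloor 2^p|x_{i_j}|/G\rfloor,\,2^p-1\}$ and $\beta_j\in\{0,1\}$ an independent Bernoulli variable of mean $2^p|x_{i_j}|/G-q_j$, so that $\mathbb E\hat x=x$. *Algorithm.* Put $B=2dG$. The direction is chosen by AdaDelay-Dist on the unit ball: with $\eta_t=\Big(\sum_{s\in S(t)}\big(\|\hat g_s\|^2+2\|\hat g_s\|\sum_{i\in\gamma_t(s)}\|\hat g_i\|\big)+B^2(2D+1)^2\Big)^{-1/2}$, $z_t$ is the Euclidean projection of $-\eta_t\sum_{s\in S(t)}\hat g_s$ onto the closed unit ball. With $\hat h_s=\langle z_s,\hat g_s\rangle$, the scale is $$v_t=\mathbb E_{\eta\sim\rho}\Big[\nu\exp\Big(-\sum_{s\in S(t)}\big(\eta\hat h_s+\eta^2\hat h_s^2+2\eta^2|\hat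 h_s|\textstyle\sum_{i\in\gamma_t(s)}|\hat h_i|\big)\Big)\eta\Big],$$ where $\rho$ has density proportional to $e^{-\eta^2}$ on $[0,a]$, $a=\big(20B(1+2D)\big)^{-1}$. The prediction is $w_t=v_tz_t$. *Conclusion.* Each code word can be written with $k$ bits, and in every round the code words sent by any node fit in $b$ bits in total. Moreover there is a universal constant $C>0$ (independent of all quantities above) such that for every such adversary and every fixed $u\in\mathbb R^d$, the joint regret $\mathcal R_T(u)=\sum_{t=1}^T(\ell_t(w_t)-\ell_t(u))$ satisfies, with $L=1+\ln\big(1+\|u\|(1+dDGT)/\nu\big)$, $$\mathbb E[\mathcal R_T(u)]\le\nu+C\,\|u\|\Big(\Big(1+G\sqrt{(1+\ln d)\big(1+\tfrac{dD}{b}\big)DT}\Big)\sqrt{L}+dDG\,L\Big)$$ for every $T$. In particular, whenever $T\ge d^2D$ and $G^2T\ge1$, $$\mathbb E[\mathcal R_T(u)]\le\nu+C\,\|u\|\;G\sqrt{\big(1+\tfrac{dD}{b}\big)DT}\;\sqrt{1+\ln d}\;L ,$$ that is, $\mathbb E[\mathcal R_T(u)]\le\nu+\|u\|\,\tilde{\mathcal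 O}\Big(G\sqrt{(1+dD/b)\,DT}\Big)$. The expectation is over the randomness of the encodings. -/

import Mathlib

open scoped BigOperators ENNReal

namespace DOCO

/-! ### Network and forwarding of messages

Rounds are numbered `0, 1, 2, …`; a gradient is identified with the round in which it is issued. -/

section Network

variable {V : Type*} [Fintype V] [DecidableEq V]

/-- State of a node at the start of a round: the indices of the gradients available to it, and the
indices of the gradients that it has already sent to its neighbours. -/
structure NodeState where
  known : Finset ℕ
  sent : Finset ℕ

/-- The gradients held by node `n` at the end of round `t`, before communication: those that were
available, and the one of round `t` if `n` is the active node. -/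
def held (I : ℕ → V) (st : V → NodeState) (t : ℕ) (n : V) : Finset ℕ :=
  if I t = n then insert t (st n).known else (st n).known

/-- Standard forwarding: the gradients that node `n` sends to all its neighbours at the end of
round `t` are those it holds and has not sent yet. A gradient is sent during at most `D` rounds
(the round `s` in which it is issued up to round `s + D - 1`), where `D` is the diameter. -/
def outgoing (D : ℕ) (I : ℕ → V) (st : V → NodeState) (t : ℕ) (n : V) : Finset ℕ :=
  (held I st t n \ (st n).sent).filter (fun s => t < s + D)

/-- The states of all nodes at the start of round `t`, for the activation sequence `I`. -/
noncomputable def netState (Gr : SimpleGraph V) [DecidableRel Gr.Adj] (I : ℕ → V) : ℕ → V → NodeState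
  | 0 => fun _ => ⟨∅, ∅⟩
  | t + 1 => fun n =>
      ⟨held I (netState Gr I t) t n ∪
          (Finset.univ.filter (fun n' => Gr.Adj n n')).biUnion
            (fun n' => outgoing Gr.diam I (netState Gr I t) t n'),
        (netState Gr I t n).sent ∪ outgoing Gr.diam I (netState Gr I t) t n⟩

/-- The gradients in the message that node `n` sends to its neighbours at the end of round `t`. -/
noncomputable def message (Gr : SimpleGraph V) [DecidableRel Gr.Adj] (I : ℕ → V) (t : ℕ) (n : V) : Finset ℕ :=
  outgoing Gr.diam I (netState Gr I t) t n

/-- The set `S_{I_t}(t)` of gradients available in round `t` to the node `I_t` active in it. -/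
noncomputable def available (Gr : SimpleGraph V) [DecidableRel Gr.Adj] (I : ℕ → V) (t : ℕ) : Finset ℕ :=
  (netState Gr I t (I t)).known

end Network

/-! ### The learning algorithms

`S t` is the set of gradients available to the active node in round `t`. -/

section Algorithms

/-- `γ(t)`: the past gradients that are missing in round `t` at the active node. -/
def missing (S : ℕ → Finset ℕ) (t : ℕ) : Finset ℕ := Finset.range t \ S t

/-- `γ_{I_t}(s) = γ(s) ∩ S_{I_t}(t)`: the gradients that were missing in round `s` at `I_s` but are
available in round `t` at `I_t`. -/
def missingSeen (S : ℕ → Finset ℕ) (t s : ℕ) : Finset ℕ := missing S s ∩ S t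

variable {E : Type*} [NormedAddCommGroup E] [InnerProductSpace ℝ E]

/-- The part of the lag that the active node of round `t` can compute from available gradients. -/
noncomputable def observedLag (S : ℕ → Finset ℕ) (g : ℕ → E) (t : ℕ) : ℝ :=
  ∑ s ∈ S t, (‖g s‖ ^ 2 + 2 * ‖g s‖ * ∑ i ∈ missingSeen S t s, ‖g i‖)

/-- Learning rate of AdaDelay-Dist, for delays bounded by `D` and gradients bounded by `B`. -/
noncomputable def adaRate (D : ℕ) (B : ℝ) (S : ℕ → Finset ℕ) (g : ℕ → E) (t : ℕ) : ℝ :=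
  (Real.sqrt (observedLag S g t + (B * (2 * D + 1)) ^ 2))⁻¹

/-- Euclidean projection onto the closed unit ball. -/
noncomputable def projBall (x : E) : E := (max 1 ‖x‖)⁻¹ • x

/-- AdaDelay-Dist on the closed unit ball: delayed dual averaging with regularizer `‖·‖² / 2`,
i.e. `z_t` minimizes `⟪∑ s ∈ S t, g s, z⟫ + ‖z‖² / (2 η_t)` over the unit ball, with `η_t` the
learning rate `adaRate`. -/
noncomputable def adaDelayDist (D : ℕ) (B : ℝ) (S : ℕ → Finset ℕ) (g : ℕ → E) (t : ℕ) : E :=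
  projBall (-(adaRate D B S g t • ∑ s ∈ S t, g s))

/-- `ζ̂_{I_t}(s)`, the correction for missing gradients. -/
noncomputable def zetaHat (ε : ℝ) (S : ℕ → Finset ℕ) (h : ℕ → ℝ) (t s : ℕ) : ℝ :=
  |h s + ε| * ∑ i ∈ missingSeen S t s, |h i + ε|

/-- Right end point of the support of the prior `ρ` on learning rates. -/
noncomputable def etaMax (D : ℕ) (B ε : ℝ) : ℝ := ((B + ε) * 20 * (1 + 2 * D))⁻¹

/-- The one-dimensional comparator-adaptive algorithm, with gradient bound `B`, error parameter
`ε`, regret `ν` at the origin and delay bound `D`: the prediction is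
`E_{η ∼ ρ} [ν exp (-∑ s ∈ S t, (η (h s + ε) + η² (h s + ε)² + 2 η² ζ̂ s)) η]`, where `ρ` has density
proportional to `exp (-η²)` on `[0, etaMax]`. -/
noncomputable def scaleAlg (D : ℕ) (B ε ν : ℝ) (S : ℕ → Finset ℕ) (h : ℕ → ℝ) (t : ℕ) : ℝ :=
  (∫ η in (0 : ℝ)..etaMax D B ε,
      ν * Real.exp (-∑ s ∈ S t,
        (η * (h s + ε) + η ^ 2 * (h s + ε) ^ 2 + 2 * η ^ 2 * zetaHat ε S h t s)) * η
      * Real.exp (-η ^ 2)) /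
    ∫ η in (0 : ℝ)..etaMax D B ε, Real.exp (-η ^ 2)

/-- The black-box reduction: play `v_t z_t`, where the direction algorithm `AZ` is fed with the
gradients `g` and the scale algorithm `AV` with `⟪z_t, g_t⟫`. -/
noncomputable def blackBox (AZ : (ℕ → E) → ℕ → E) (AV : (ℕ → ℝ) → ℕ → ℝ) (g : ℕ → E) (t : ℕ) : E :=
  AV (fun s => inner ℝ (AZ g s) (g s)) t • AZ g t

end Algorithms

/-! ### Sparsified quantization -/

section Encoding

/-- The Bernoulli distribution with success probability `q` (clipped to `[0, 1]`). -/
noncomputable def coin (q : ℝ) : PMF Bool :=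
  PMF.ofFintype
    (fun c => ENNReal.ofReal (if c then max 0 (min 1 q) else 1 - max 0 (min 1 q))) (by
      have h0 : (0 : ℝ) ≤ max 0 (min 1 q) := le_max_left _ _
      have h1 : max 0 (min 1 q) ≤ (1 : ℝ) := max_le zero_le_one (min_le_left _ _)
      rw [Fintype.sum_bool]
      simp only [if_true, Bool.false_eq_true, if_false]
      rw [← ENNReal.ofReal_add h0 (by linarith)]
      simp)

/-- The law of `m` independent draws from `q`. -/
noncomputable def iidDraws {α : Type*} [Fintype α] (q : PMF α) (m : ℕ) : PMF (Fin m → α) :=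
  PMF.ofFintype (fun f => ∏ j, q (f j)) (by
    classical
    have h := Finset.prod_univ_sum (fun _ : Fin m => (Finset.univ : Finset α)) (fun _ a => q a)
    have hq : ∑ a, q a = 1 := by rw [← tsum_fintype (L := .unconditional _)]; exact q.tsum_coe
    rw [Fintype.piFinset_univ] at h
    rw [← h]
    simp [hq])

/-- A quantized coordinate: sign bit (`true` for negative), `p` digits, rounding bit. -/
abbrev QuantCode (p : ℕ) := Bool × Fin (2 ^ p) × Bool

/-- A code word: `m` repetitions of a coordinate index and a quantized coordinate. -/
abbrev Code (d m p : ℕ) := Fin m → Fin d × QuantCode p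

/-- The first `p` binary digits of `|y| / G`, as an integer in `{0, …, 2 ^ p - 1}`. (The boundary
case `|y| = G` is written as `0.11…1` and is then always rounded up.) -/
noncomputable def digits (p : ℕ) (G y : ℝ) : Fin (2 ^ p) :=
  ⟨min ⌊2 ^ p * |y| / G⌋₊ (2 ^ p - 1), by
    have : 0 < 2 ^ p := by positivity
    omega⟩

/-- `p`-level stochastic quantization of a coordinate `y ∈ [-G, G]`: truncate to `p` digits and
round up at random, with the probability that makes the decoded value unbiased. -/
noncomputable def quantize (p : ℕ) (G y : ℝ) : PMF (QuantCode p) :=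
  (coin (2 ^ p * |y| / G - ((digits p G y : ℕ) : ℝ))).map
    (fun c => (decide (y < 0), digits p G y, c))

/-- The value of a quantized coordinate. -/
noncomputable def dequantize {p : ℕ} (G : ℝ) (q : QuantCode p) : ℝ :=
  (if q.1 then -1 else 1) * (G / 2 ^ p) * (((q.2.1 : ℕ) : ℝ) + if q.2.2 then 1 else 0)

/-- Sparsified quantization with precision `p` and `m` repetitions: in each repetition, draw a
coordinate uniformly at random and quantize it. -/
noncomputable def encode (d m p : ℕ) [NeZero d] (G : ℝ) (x : EuclideanSpace ℝ (Fin d)) :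
    PMF (Code d m p) :=
  iidDraws ((PMF.uniformOfFintype (Fin d)).bind
    (fun i => (quantize p G (x i)).map (fun q => (i, q)))) m

/-- The decoder: the average over the repetitions of `d x̃_i e_i`. -/
noncomputable def decode {d m p : ℕ} (G : ℝ) (c : Code d m p) : EuclideanSpace ℝ (Fin d) :=
  (m : ℝ)⁻¹ • ∑ j, EuclideanSpace.single (c j).1 ((d : ℝ) * dequantize G (c j).2)

/-- The precision `p = ⌈log₂ d⌉`. -/
def precision (d : ℕ) : ℕ := Nat.clog 2 d

/-- The number of repetitions `m = ⌊k / (3 ⌈log₂ d⌉ + 2)⌋` for a budget of `k` bits per gradient. -/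
def repetitions (d k : ℕ) : ℕ := k / (3 * Nat.clog 2 d + 2)

/-- The code words used with a budget of `k` bits per gradient. -/
abbrev Word (d k : ℕ) := Code d (repetitions d k) (precision d)

end Encoding

/-! ### The game -/

section Game

/-- A (non-oblivious) adversary. The list of all code words produced so far is the history; its
length is the index of the current round. Everything else that happened (the predictions and the
previous choices of the adversary) is a function of it. -/
structure Adversary (V : Type*) (d k : ℕ) where
  /-- the agent activated in the current round -/
  agent : List (Word d k) → V
  /-- the loss function of the current round -/
  loss : List (Word d k) → EuclideanSpace ℝ (Fin d) → ℝ
  /-- the gradient revealed to the active agent -/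
  grad : List (Word d k) → EuclideanSpace ℝ (Fin d)

variable {V : Type*} {d k : ℕ}

/-- The activation sequence along a history `h` (meaningful for rounds up to `h.length`). -/
def Adversary.activations (adv : Adversary V d k) (h : List (Word d k)) (s : ℕ) : V :=
  adv.agent (h.take s)

/-- The decoded gradients along a history `h`. -/
noncomputable def estimates (G : ℝ) (h : List (Word d k)) (s : ℕ) : EuclideanSpace ℝ (Fin d) :=
  (h[s]?).elim 0 (decode G)

/-- The prediction of the active agent in round `h.length`, after the history `h`: the black-box
reduction with AdaDelay-Dist and the comparator-adaptive scale algorithm, tuned with error parameter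
`0` and the bound `2 d G` on the norms of the decoded gradients. -/
noncomputable def prediction [Fintype V] [DecidableEq V] (Gr : SimpleGraph V) [DecidableRel Gr.Adj]
    (G ν : ℝ) (adv : Adversary V d k) (h : List (Word d k)) : EuclideanSpace ℝ (Fin d) :=
  blackBox
    (adaDelayDist Gr.diam (2 * d * G) (available Gr (adv.activations h)))
    (scaleAlg Gr.diam (2 * d * G) 0 ν (available Gr (adv.activations h)))
    (estimates G h) h.length

/-- The rules for the adversary in rounds before `T`: convex losses, and subgradients of norm at
most `G` at the point predicted by the active agent. -/
def Adversary.Admissible [Fintype V] [DecidableEq V] (adv : Adversary V d k) (Gr : SimpleGraph V)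
    [DecidableRel Gr.Adj] (G ν : ℝ) (T : ℕ) : Prop :=
  ∀ h : List (Word d k), h.length < T →
    ConvexOn ℝ Set.univ (adv.loss h) ∧
    (∀ y, adv.loss h (prediction Gr G ν adv h) +
      inner ℝ (adv.grad h) (y - prediction Gr G ν adv h) ≤ adv.loss h y) ∧
    ‖adv.grad h‖ ≤ G

/-- The law of the history after `t` rounds: in each round the gradient is encoded with fresh
randomness. -/
noncomputable def history [NeZero d] (G : ℝ) (adv : Adversary V d k) : ℕ → PMF (List (Word d k))
  | 0 => PMF.pure []
  | t + 1 => (history G adv t).bind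
      (fun h => (encode d (repetitions d k) (precision d) G (adv.grad h)).map (fun c => h ++ [c]))

/-- The joint regret over `T` rounds with respect to `u`, along a history `h` of length `T`. -/
noncomputable def regret [Fintype V] [DecidableEq V] (Gr : SimpleGraph V) [DecidableRel Gr.Adj]
    (G ν : ℝ) (adv : Adversary V d k) (T : ℕ) (u : EuclideanSpace ℝ (Fin d))
    (h : List (Word d k)) : ℝ :=
  ∑ t ∈ Finset.range T,
    (adv.loss (h.take t) (prediction Gr G ν adv (h.take t)) - adv.loss (h.take t) u)

/-- The expected joint regret (the law of the history has finite support). -/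
noncomputable def expectedRegret [Fintype V] [DecidableEq V] [NeZero d] (Gr : SimpleGraph V)
    [DecidableRel Gr.Adj] (G ν : ℝ) (adv : Adversary V d k) (T : ℕ)
    (u : EuclideanSpace ℝ (Fin d)) : ℝ :=
  ∑' h, ((history G adv T) h).toReal * regret Gr G ν adv T u h

/-- The logarithmic factor `1 + ln (1 + U (1 + d D G T) / ν)`. -/
noncomputable def logFactor (d D T : ℕ) (G ν U : ℝ) : ℝ :=
  1 + Real.log (1 + U * (1 + d * D * G * T) / ν)

end Game

end DOCO

/-! Convexity linearizes the losses. A code word is drawn after the prediction it answers, so in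
expectation the true gradients may be replaced by their unbiased estimates `ĝ_s`
(`expect_sum_inner_grad`). What remains is a pathwise bound for linear losses with delayed feedback.
Its complexity measure is the lag `Λ`, the sum over rounds `s` of `‖ĝ_s‖² + 2 ‖ĝ_s‖ ∑ ‖ĝ_i‖`, with
`i` ranging over the indices missing in round `s`.

Forwarding along shortest paths makes every gradient available everywhere after `D` rounds
(`mem_available_of_diam_le`). Since `w_t = v_t z_t`, the regret splits into that of the scale
against `‖u‖` and `‖u‖` times that of the direction against a unit-ball vector
(`BoundedDelay.blackBox_regret`). Each algorithm is compared with an ideal one that sees the whole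
past. The discrepancy in round `t` is of the order of the learning rate times the missing mass `∑
‖ĝ_i‖`, and after multiplication by the current gradient it is paid for by the cross term of the
lag.

For the direction, the ideal is dual averaging with rate `(Λ_t + c)^(-1/2)`
(`BoundedDelay.adaDelayDist_regret`). For the scale, it is a family of bettors indexed by `η`: the
fall of the wealth `ν exp(-η ∑ h - η² Λ)` dominates the loss in each round, even when the bet is
computed from stale wealth (`BoundedDelay.seenWealth_mul_le`). Summing telescopes, and
`scale_tradeoff` balances the final mixture of wealths against the comparator.

Finally `Λ ≤ 2 D ∑ ‖ĝ_s‖²` on every path (`BoundedDelay.lag_le_sum_sq`), the estimates have second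
moment at most `G² (1 + 2d/m)` (`expect_norm_sq_decode_le`), and Jensen's inequality for the square
root yields the main term. -/

namespace DOCO

/-! ### Propagation of gradients through the network, and message sizes. -/

section NetworkLemmas

variable {V : Type*} [DecidableEq V]

theorem held_subset_range {I : ℕ → V} {st : V → NodeState} {t : ℕ} {n : V}
    (h : (st n).known ⊆ Finset.range t) : held I st t n ⊆ Finset.range (t + 1) := by
  intro s hs
  unfold held at hs
  split_ifs at hs
  · rcases Finset.mem_insert.1 hs with rfl | hs
    · simp
    · have := Finset.mem_range.1 (h hs)
      exact Finset.mem_range.2 (by omega)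
  · have := Finset.mem_range.1 (h hs)
    exact Finset.mem_range.2 (by omega)

theorem outgoing_subset_held (D : ℕ) (I : ℕ → V) (st : V → NodeState) (t : ℕ) (n : V) :
    outgoing D I st t n ⊆ held I st t n := fun _ hs =>
  (Finset.mem_sdiff.1 (Finset.mem_filter.1 hs).1).1

theorem known_subset_held (I : ℕ → V) (st : V → NodeState) (t : ℕ) (n : V) :
    (st n).known ⊆ held I st t n := by
  unfold held
  split_ifs
  · exact Finset.subset_insert _ _
  · exact subset_rfl

variable [Fintype V] (Gr : SimpleGraph V) [DecidableRel Gr.Adj] (I : ℕ → V)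

theorem known_subset_range (t : ℕ) (n : V) : (netState Gr I t n).known ⊆ Finset.range t := by
  induction t generalizing n with
  | zero => simp [netState]
  | succ t ih =>
    simp only [netState]
    refine Finset.union_subset (held_subset_range (ih n)) ?_
    refine Finset.biUnion_subset.2 fun n' _ => ?_
    exact (outgoing_subset_held _ _ _ _ _).trans (held_subset_range (ih n'))

/-- The forwarding window starts in the round of issue, so anything sent in round `t` was issued in
one of the `D` rounds ending with `t`. -/
theorem message_card_le (t : ℕ) (n : V) : (message Gr I t n).card ≤ Gr.diam := by
  have h : message Gr I t n ⊆ Finset.Ico (t + 1 - Gr.diam) (t + 1) := by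
    intro s hs
    have h1 := Finset.mem_range.1
      (held_subset_range (known_subset_range Gr I t n) (outgoing_subset_held _ _ _ _ _ hs))
    have h2 : t < s + Gr.diam := (Finset.mem_filter.1 hs).2
    exact Finset.mem_Ico.2 ⟨by omega, h1⟩
  have h' := Finset.card_le_card h
  rw [Nat.card_Ico] at h'
  omega

theorem held_subset_known_succ (t : ℕ) (n : V) :
    held I (netState Gr I t) t n ⊆ (netState Gr I (t + 1) n).known := by
  simp only [netState]
  exact Finset.subset_union_left

theorem known_mono {s t : ℕ} (h : s ≤ t) (n : V) :
    (netState Gr I s n).known ⊆ (netState Gr I t n).known := by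
  induction h with
  | refl => exact subset_rfl
  | step _ ih =>
    exact ih.trans ((known_subset_held I _ _ n).trans (held_subset_known_succ Gr I _ n))

theorem outgoing_subset_known_succ {n n' : V} (h : Gr.Adj n n') (t : ℕ) :
    outgoing Gr.diam I (netState Gr I t) t n' ⊆ (netState Gr I (t + 1) n).known := by
  simp only [netState]
  refine Finset.Subset.trans ?_ Finset.subset_union_right
  exact Finset.subset_biUnion_of_mem (fun n' => outgoing Gr.diam I (netState Gr I t) t n')
    (Finset.mem_filter.2 ⟨Finset.mem_univ _, h⟩)

/-- Never repeating a transmission loses nothing: the neighbours received it the first time. -/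
theorem sent_subset_known {n n' : V} (h : Gr.Adj n n') (t : ℕ) :
    (netState Gr I t n').sent ⊆ (netState Gr I t n).known := by
  induction t with
  | zero => simp [netState]
  | succ t ih =>
    have h1 : (netState Gr I (t + 1) n').sent =
      (netState Gr I t n').sent ∪ outgoing Gr.diam I (netState Gr I t) t n' := rfl
    rw [h1]
    exact Finset.union_subset (ih.trans (known_mono Gr I (Nat.le_succ t) n))
      (outgoing_subset_known_succ Gr I h t)

/-- Induction along the walk: the next node holds `s` one round earlier, and either passes it on now
or has done so before. The bound on the length keeps `s` inside the forwarding window. -/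
theorem mem_held_of_walk {s : ℕ} {n v : V} (p : Gr.Walk n v) (hv : I s = v)
    (hp : p.length ≤ Gr.diam) : s ∈ held I (netState Gr I (s + p.length)) (s + p.length) n := by
  induction p with
  | nil => simp [held, hv]
  | @cons n m v hnm p ih =>
    rw [SimpleGraph.Walk.length_cons] at hp ⊢
    have ih' := ih hv (by omega)
    apply known_subset_held
    by_cases hs : s ∈ (netState Gr I (s + p.length) m).sent
    · exact known_mono Gr I (by omega) n (sent_subset_known Gr I hnm _ hs)
    · refine outgoing_subset_known_succ Gr I hnm (s + p.length) ?_
      exact Finset.mem_filter.2 ⟨Finset.mem_sdiff.2 ⟨ih', hs⟩, by omega⟩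

theorem mem_known_of_diam_le (hc : Gr.Connected) (hD : 0 < Gr.diam) {s t : ℕ}
    (h : s + Gr.diam ≤ t) (n : V) : s ∈ (netState Gr I t n).known := by
  have : Nonempty V := ⟨n⟩
  obtain ⟨p, hp⟩ := hc.exists_walk_length_eq_dist n (I s)
  have hd : Gr.dist n (I s) ≤ Gr.diam :=
    SimpleGraph.dist_le_diam (SimpleGraph.connected_iff_ediam_ne_top.1 hc)
  have h1 := mem_held_of_walk Gr I p rfl (by omega)
  -- At the issuing node the gradient becomes available only one round after its issue, which is
  -- where `0 < D` enters.
  by_cases h0 : p.length = 0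
  · rw [h0] at h1
    exact known_mono Gr I (by omega) n (held_subset_known_succ Gr I _ n h1)
  · have h2 : s ∈ (netState Gr I (s + p.length) n).known := by
      unfold held at h1
      split_ifs at h1
      · rcases Finset.mem_insert.1 h1 with h3 | h3
        · omega
        · exact h3
      · exact h1
    exact known_mono Gr I (by omega) n h2

theorem netState_congr {I I' : ℕ → V} {t : ℕ} (h : ∀ s < t, I s = I' s) :
    netState Gr I t = netState Gr I' t := by
  induction t with
  | zero => rfl
  | succ t ih =>
    have ih' := ih fun s hs => h s (by omega)
    have h1 : ∀ st n, held I st t n = held I' st t n := fun st n => by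
      simp [held, h t (Nat.lt_succ_self t)]
    have h2 : ∀ D st n, outgoing D I st t n = outgoing D I' st t n := fun D st n => by
      simp [outgoing, h1]
    funext n
    simp only [netState, ih', h1, h2]

theorem available_congr {I I' : ℕ → V} {t : ℕ} (h : ∀ s ≤ t, I s = I' s) :
    available Gr I t = available Gr I' t := by
  unfold available
  rw [netState_congr Gr (I := I) (I' := I') fun s hs => h s hs.le, h t le_rfl]

theorem available_subset_range (t : ℕ) : available Gr I t ⊆ Finset.range t :=
  known_subset_range Gr I t _

theorem mem_available_of_diam_le (hc : Gr.Connected) (hD : 0 < Gr.diam) {s t : ℕ}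
    (h : s + Gr.diam ≤ t) : s ∈ available Gr I t :=
  mem_known_of_diam_le Gr I hc hD h _

end NetworkLemmas

/-- By counting. With `d ≤ 2 ^ p`, one repetition takes at most `2 ^ (2 p + 2)` values, which is
within the `3 p + 2` bits allotted to it. -/
theorem nonempty_word_embedding (d k : ℕ) : Nonempty (Word d k ↪ (Fin k → Bool)) := by
  apply Function.Embedding.nonempty_of_card_le
  simp only [Fintype.card_fun, Fintype.card_prod, Fintype.card_fin, Fintype.card_bool]
  have hd : d ≤ 2 ^ precision d := Nat.le_pow_clog one_lt_two d
  calc (d * (2 * (2 ^ precision d * 2))) ^ repetitions d k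
      ≤ (2 ^ (3 * precision d + 2)) ^ repetitions d k := by
        gcongr
        calc d * (2 * (2 ^ precision d * 2)) ≤ 2 ^ precision d * (2 * (2 ^ precision d * 2)) := by
              gcongr
          _ = 2 ^ (2 * precision d + 2) := by ring
          _ ≤ _ := Nat.pow_le_pow_right (by norm_num) (by omega)
    _ = 2 ^ ((3 * precision d + 2) * repetitions d k) := by rw [pow_mul]
    _ ≤ 2 ^ k := Nat.pow_le_pow_right (by norm_num) (Nat.mul_div_le _ _)

/-! ### The lag, and its difference from what is observed. -/

section Lag

/-- The contribution of round `s` to the lag, for gradients of size `a`. -/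
noncomputable def lagTerm (S : ℕ → Finset ℕ) (a : ℕ → ℝ) (s : ℕ) : ℝ :=
  a s ^ 2 + 2 * a s * ∑ i ∈ missing S s, a i

/-- The lag of the first `t` rounds. -/
noncomputable def lag (S : ℕ → Finset ℕ) (a : ℕ → ℝ) (t : ℕ) : ℝ :=
  ∑ s ∈ Finset.range t, lagTerm S a s

/-- The part of the lag observed in round `t`. -/
noncomputable def seenLag (S : ℕ → Finset ℕ) (a : ℕ → ℝ) (t : ℕ) : ℝ :=
  ∑ s ∈ S t, (a s ^ 2 + 2 * a s * ∑ i ∈ missingSeen S t s, a i)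

/-- The sets `S t` of available rounds are causal, with delays at most `D`. -/
structure BoundedDelay (D : ℕ) (S : ℕ → Finset ℕ) : Prop where
  pos : 0 < D
  subset_range : ∀ t, S t ⊆ Finset.range t
  mem_of_le : ∀ s t, s + D ≤ t → s ∈ S t

variable {D : ℕ} {S : ℕ → Finset ℕ} {a : ℕ → ℝ} {B : ℝ}

theorem BoundedDelay.lt_of_mem_missing (hS : BoundedDelay D S) {i t : ℕ} (h : i ∈ missing S t) :
    i < t ∧ t < i + D := by
  have h1 := Finset.mem_sdiff.1 h
  refine ⟨Finset.mem_range.1 h1.1, ?_⟩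
  by_contra h2
  exact h1.2 (hS.mem_of_le i t (by omega))

theorem BoundedDelay.card_missing (hS : BoundedDelay D S) (t : ℕ) :
    ((missing S t).card : ℝ) ≤ D - 1 := by
  have h : missing S t ⊆ Finset.Ico (t + 1 - D) t := fun i hi => by
    have := hS.lt_of_mem_missing hi
    exact Finset.mem_Ico.2 (by omega)
  have h' := Finset.card_le_card h
  rw [Nat.card_Ico] at h'
  have hD := hS.pos
  have : (missing S t).card + 1 ≤ D := by omega
  have : ((missing S t).card : ℝ) + 1 ≤ D := by exact_mod_cast this
  linarith

theorem BoundedDelay.sum_missing_le (hS : BoundedDelay D S) (ha : ∀ s, a s ≤ B) (t : ℕ)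
    (hB : 0 ≤ B) : ∑ i ∈ missing S t, a i ≤ (D - 1) * B := by
  calc ∑ i ∈ missing S t, a i ≤ (missing S t).card • B := Finset.sum_le_card_nsmul _ _ _ fun i _ => ha i
    _ = (missing S t).card * B := nsmul_eq_mul _ _
    _ ≤ _ := by gcongr; exact hS.card_missing t

theorem sum_nonneg_of_nonneg (ha0 : ∀ s, 0 ≤ a s) (s : Finset ℕ) : 0 ≤ ∑ i ∈ s, a i :=
  Finset.sum_nonneg fun i _ => ha0 i

theorem sq_le_lagTerm (ha0 : ∀ s, 0 ≤ a s) (s : ℕ) : a s ^ 2 ≤ lagTerm S a s := by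
  have := mul_nonneg (ha0 s) (sum_nonneg_of_nonneg ha0 (missing S s))
  unfold lagTerm
  linarith

theorem lagTerm_nonneg (ha0 : ∀ s, 0 ≤ a s) (s : ℕ) : 0 ≤ lagTerm S a s :=
  (sq_nonneg _).trans (sq_le_lagTerm ha0 s)

theorem lag_nonneg (ha0 : ∀ s, 0 ≤ a s) (t : ℕ) : 0 ≤ lag S a t :=
  Finset.sum_nonneg fun s _ => lagTerm_nonneg ha0 s

theorem lag_mono_right {a' : ℕ → ℝ} (ha0 : ∀ s, 0 ≤ a s) (h : ∀ s, a s ≤ a' s) (t : ℕ) :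
    lag S a t ≤ lag S a' t := by
  unfold lag lagTerm
  gcongr with s _
  · exact ha0 s
  · exact h s
  · exact sum_nonneg_of_nonneg ha0 _
  · exact mul_nonneg zero_le_two ((ha0 s).trans (h s))
  · exact h s
  · exact h _

theorem BoundedDelay.lagTerm_le (hS : BoundedDelay D S) (ha0 : ∀ s, 0 ≤ a s) (ha : ∀ s, a s ≤ B)
    (s : ℕ) : lagTerm S a s ≤ a s * ((2 * D - 1) * B) := by
  have hB : 0 ≤ B := (ha0 0).trans (ha 0)
  have h1 := mul_le_mul_of_nonneg_left (hS.sum_missing_le ha s hB) (ha0 s)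
  have h2 := mul_le_mul_of_nonneg_left (ha s) (ha0 s)
  unfold lagTerm
  nlinarith

theorem BoundedDelay.lag_le (hS : BoundedDelay D S) (ha0 : ∀ s, 0 ≤ a s) (ha : ∀ s, a s ≤ B)
    (t : ℕ) : lag S a t ≤ t * ((2 * D - 1) * B ^ 2) := by
  have hB : 0 ≤ B := (ha0 0).trans (ha 0)
  have hD : (1 : ℝ) ≤ D := by exact_mod_cast hS.pos
  have : ∀ s ∈ Finset.range t, lagTerm S a s ≤ (2 * D - 1) * B ^ 2 := fun s _ => by
    refine (hS.lagTerm_le ha0 ha s).trans ?_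
    calc a s * ((2 * D - 1) * B) ≤ B * ((2 * D - 1) * B) := by
          gcongr
          · nlinarith
          · exact ha s
      _ = _ := by ring
  have h2 := Finset.sum_le_card_nsmul _ _ _ this
  simpa [lag] using h2

/-- AM-GM splits each cross term `2 a_s a_i` into squares; a round misses fewer than `D` indices,
and an index is missing in at most `D` rounds. The bound no longer depends on which indices are
missing. -/
theorem BoundedDelay.lag_le_sum_sq (hS : BoundedDelay D S) (a : ℕ → ℝ) (t : ℕ) :
    lag S a t ≤ 2 * D * ∑ s ∈ Finset.range t, a s ^ 2 := by
  have h1 : ∀ s, lagTerm S a s ≤ D * a s ^ 2 + ∑ i ∈ missing S s, a i ^ 2 := fun s => by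
    have : 2 * a s * ∑ i ∈ missing S s, a i ≤ ∑ i ∈ missing S s, (a s ^ 2 + a i ^ 2) := by
      rw [Finset.mul_sum]
      exact Finset.sum_le_sum fun i _ => by nlinarith [sq_nonneg (a s - a i)]
    rw [Finset.sum_add_distrib, Finset.sum_const, nsmul_eq_mul] at this
    have h2 := mul_le_mul_of_nonneg_right (hS.card_missing s) (sq_nonneg (a s))
    unfold lagTerm
    linarith
  have h2 : ∑ s ∈ Finset.range t, ∑ i ∈ missing S s, a i ^ 2 ≤
      ∑ i ∈ Finset.range t, D * a i ^ 2 := by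
    have : ∀ s ∈ Finset.range t, ∑ i ∈ missing S s, a i ^ 2 =
        ∑ i ∈ Finset.range t, if i ∈ missing S s then a i ^ 2 else 0 := fun s hs => by
      rw [← Finset.sum_filter]
      refine Finset.sum_congr ?_ fun _ _ => rfl
      ext i
      have := Finset.mem_range.1 hs
      simp only [Finset.mem_filter, Finset.mem_range]
      exact ⟨fun h => ⟨(hS.lt_of_mem_missing h).1.trans this, h⟩, fun h => h.2⟩
    rw [Finset.sum_congr rfl this, Finset.sum_comm]
    refine Finset.sum_le_sum fun i _ => ?_
    rw [← Finset.sum_filter, Finset.sum_const, nsmul_eq_mul]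
    gcongr
    have h3 : (Finset.range t).filter (fun s => i ∈ missing S s) ⊆ Finset.Ico i (i + D) :=
      fun s hs => by
        have := hS.lt_of_mem_missing (Finset.mem_filter.1 hs).2
        exact Finset.mem_Ico.2 (by omega)
    simpa using Finset.card_le_card h3
  calc lag S a t ≤ ∑ s ∈ Finset.range t, (D * a s ^ 2 + ∑ i ∈ missing S s, a i ^ 2) :=
        Finset.sum_le_sum fun s _ => h1 s
    _ ≤ _ := by
        rw [Finset.sum_add_distrib, Finset.mul_sum]
        rw [← Finset.mul_sum] at h2 ⊢
        rw [← Finset.mul_sum]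
        linarith

theorem BoundedDelay.range_eq (hS : BoundedDelay D S) (t : ℕ) :
    Finset.range t = S t ∪ missing S t := by
  rw [missing, Finset.union_sdiff_of_subset (hS.subset_range t)]

theorem BoundedDelay.sum_range_eq {M : Type*} [AddCommMonoid M] (hS : BoundedDelay D S) (t : ℕ)
    (f : ℕ → M) :
    ∑ s ∈ Finset.range t, f s = ∑ s ∈ S t, f s + ∑ s ∈ missing S t, f s := by
  rw [hS.range_eq t, Finset.sum_union]
  exact Finset.disjoint_sdiff

theorem BoundedDelay.lag_sub_seenLag (hS : BoundedDelay D S) (t : ℕ) :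
    lag S a t - seenLag S a t = ∑ s ∈ missing S t, lagTerm S a s +
      ∑ s ∈ S t, 2 * a s * ∑ i ∈ missing S s \ S t, a i := by
  have h1 : ∀ s, lagTerm S a s = (a s ^ 2 + 2 * a s * ∑ i ∈ missingSeen S t s, a i) +
      2 * a s * ∑ i ∈ missing S s \ S t, a i := fun s => by
    rw [lagTerm, missingSeen, ← Finset.sum_inter_add_sum_sdiff (missing S s) (S t)]
    ring
  rw [lag, hS.sum_range_eq t, Finset.sum_congr rfl fun s _ => h1 s, Finset.sum_add_distrib, seenLag]
  ring

theorem BoundedDelay.seenLag_le_lag (hS : BoundedDelay D S) (ha0 : ∀ s, 0 ≤ a s) (t : ℕ) :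
    seenLag S a t ≤ lag S a t := by
  have h := hS.lag_sub_seenLag (a := a) t
  have h1 : 0 ≤ ∑ s ∈ missing S t, lagTerm S a s := Finset.sum_nonneg fun s _ => lagTerm_nonneg ha0 s
  have h2 : 0 ≤ ∑ s ∈ S t, 2 * a s * ∑ i ∈ missing S s \ S t, a i :=
    Finset.sum_nonneg fun s _ =>
      mul_nonneg (mul_nonneg zero_le_two (ha0 s)) (sum_nonneg_of_nonneg ha0 _)
  linarith

/-- Everything unobserved is charged to an index missing in round `t`: either the whole term of that
index, or its cross terms with the at most `D` available rounds in which it was already missing. -/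
theorem BoundedDelay.lag_sub_seenLag_le (hS : BoundedDelay D S) (ha0 : ∀ s, 0 ≤ a s)
    (ha : ∀ s, a s ≤ B) (t : ℕ) :
    lag S a t - seenLag S a t ≤ 4 * D * B * ∑ i ∈ missing S t, a i := by
  have hB : 0 ≤ B := (ha0 0).trans (ha 0)
  rw [hS.lag_sub_seenLag]
  have h1 : ∑ s ∈ missing S t, lagTerm S a s ≤ 2 * D * B * ∑ i ∈ missing S t, a i := by
    rw [Finset.mul_sum]
    refine Finset.sum_le_sum fun s _ => (hS.lagTerm_le ha0 ha s).trans ?_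
    have := mul_nonneg (ha0 s) hB
    linarith
  have h2 : ∑ s ∈ S t, 2 * a s * ∑ i ∈ missing S s \ S t, a i ≤
      2 * D * B * ∑ i ∈ missing S t, a i := by
    have : ∀ s ∈ S t, 2 * a s * ∑ i ∈ missing S s \ S t, a i =
        ∑ i ∈ missing S t, if i ∈ missing S s then 2 * a s * a i else 0 := fun s hs => by
      rw [← Finset.sum_filter, Finset.mul_sum]
      refine Finset.sum_congr ?_ fun _ _ => rfl
      ext i
      simp only [Finset.mem_filter, Finset.mem_sdiff, missing, Finset.mem_range]
      have := Finset.mem_range.1 (hS.subset_range t hs)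
      constructor
      · rintro ⟨⟨h1, h2⟩, h3⟩
        exact ⟨⟨by omega, h3⟩, h1, h2⟩
      · rintro ⟨⟨h1, h2⟩, h3⟩
        exact ⟨h3, h2⟩
    rw [Finset.sum_congr rfl this, Finset.sum_comm, Finset.mul_sum]
    refine Finset.sum_le_sum fun i _ => ?_
    rw [← Finset.sum_filter]
    have h3 : (S t).filter (fun s => i ∈ missing S s) ⊆ Finset.Ico i (i + D) :=
      fun s hs => by
        have := hS.lt_of_mem_missing (Finset.mem_filter.1 hs).2
        exact Finset.mem_Ico.2 (by omega)
    have h4 : (((S t).filter (fun s => i ∈ missing S s)).card : ℝ) ≤ D := by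
      exact_mod_cast (by simpa using Finset.card_le_card h3)
    have h5 : ∀ s ∈ (S t).filter (fun s => i ∈ missing S s), 2 * a s * a i ≤ 2 * B * a i :=
      fun s _ => by
        have := mul_le_mul_of_nonneg_right (ha s) (ha0 i)
        linarith
    have h6 := Finset.sum_le_card_nsmul _ _ _ h5
    rw [nsmul_eq_mul] at h6
    have h7 := mul_le_mul_of_nonneg_right h4 (mul_nonneg (mul_nonneg zero_le_two hB) (ha0 i))
    linarith
  linarith

/-- Summation of `λ_t / √(c + ∑ s < t, λ_s)` when the increments are at most `c`. -/
theorem sum_div_sqrt_le {f : ℕ → ℝ} {c : ℝ} (hf : ∀ s, 0 ≤ f s) (hfc : ∀ s, f s ≤ c) (hc : 0 < c)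
    (T : ℕ) : ∑ t ∈ Finset.range T, f t * (√(∑ s ∈ Finset.range t, f s + c))⁻¹ ≤
      3 * √(∑ s ∈ Finset.range T, f s + c) := by
  induction T with
  | zero => simp
  | succ T ih =>
    rw [Finset.sum_range_succ, Finset.sum_range_succ]
    set X := ∑ s ∈ Finset.range T, f s + c with hX
    have hXc : c ≤ X := by
      have : 0 ≤ ∑ s ∈ Finset.range T, f s := Finset.sum_nonneg fun s _ => hf s
      linarith
    have hX0 : 0 < √X := Real.sqrt_pos.2 (hc.trans_le hXc)
    have e : ∑ s ∈ Finset.range T, f s + f T + c = X + f T := by rw [hX]; ring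
    rw [e]
    have h1 : √X ^ 2 = X := Real.sq_sqrt (hc.le.trans hXc)
    have h2 : √(X + f T) ^ 2 = X + f T := Real.sq_sqrt (by linarith [hf T])
    -- Because `f T ≤ c ≤ X`. Then `f T`, as a difference of squares, is at most `3 √X` times the
    -- increment of the root.
    have h3 : √(X + f T) ≤ 2 * √X := by
      rw [Real.sqrt_le_left (by positivity)]
      nlinarith [hfc T, hf T]
    have h4 : √X ≤ √(X + f T) := Real.sqrt_le_sqrt (by linarith [hf T])
    have h5 : f T * (√X)⁻¹ ≤ 3 * √(X + f T) - 3 * √X := by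
      rw [← div_eq_mul_inv, div_le_iff₀ hX0]
      nlinarith
    linarith

end Lag

/-! ### Regret of the direction on the unit ball. -/

section Direction

variable {E : Type*} [NormedAddCommGroup E] [InnerProductSpace ℝ E]

theorem norm_projBall_le (x : E) : ‖projBall x‖ ≤ 1 := by
  have h : (0 : ℝ) < max 1 ‖x‖ := lt_max_of_lt_left one_pos
  rw [projBall, norm_smul, norm_inv, Real.norm_of_nonneg h.le, inv_mul_le_iff₀ h, mul_one]
  exact le_max_right _ _

/-- The variational inequality characterizing the projection onto the unit ball. -/
theorem inner_sub_projBall_nonpos (x : E) {z : E} (hz : ‖z‖ ≤ 1) :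
    inner ℝ (x - projBall x) (z - projBall x) ≤ 0 := by
  by_cases hx : ‖x‖ ≤ 1
  · simp [projBall, max_eq_left hx]
  · push Not at hx
    have h0 : 0 < ‖x‖ := one_pos.trans hx
    rw [projBall, max_eq_right hx.le]
    have h1 : x - ‖x‖⁻¹ • x = (1 - ‖x‖⁻¹) • x := by rw [sub_smul, one_smul]
    have h2 : 0 ≤ 1 - ‖x‖⁻¹ := by
      have := inv_le_one_of_one_le₀ hx.le
      linarith
    rw [h1, real_inner_smul_left, inner_sub_right, real_inner_smul_right,
      real_inner_self_eq_norm_sq]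
    have h3 : ‖x‖⁻¹ * ‖x‖ ^ 2 = ‖x‖ := by field_simp
    rw [h3]
    have h4 : inner ℝ x z ≤ ‖x‖ * ‖z‖ := real_inner_le_norm _ _
    refine mul_nonpos_of_nonneg_of_nonpos h2 ?_
    nlinarith

theorem norm_projBall_sub_le (x y : E) : ‖projBall x - projBall y‖ ≤ ‖x - y‖ := by
  have h1 := inner_sub_projBall_nonpos x (norm_projBall_le y)
  have h2 := inner_sub_projBall_nonpos y (norm_projBall_le x)
  have h3 : ‖projBall x - projBall y‖ ^ 2 ≤ inner ℝ (x - y) (projBall x - projBall y) := by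
    have e : inner ℝ (x - y) (projBall x - projBall y) - ‖projBall x - projBall y‖ ^ 2 =
        -inner ℝ (x - projBall x) (projBall y - projBall x) -
          inner ℝ (y - projBall y) (projBall x - projBall y) := by
      rw [← real_inner_self_eq_norm_sq]
      simp only [inner_sub_left, inner_sub_right]
      ring
    linarith
  have h4 := real_inner_le_norm (x - y) (projBall x - projBall y)
  by_contra! h
  have h5 : 0 < ‖projBall x - projBall y‖ := (norm_nonneg _).trans_lt h
  nlinarith

/-- Rescaling the argument of the projection by a factor in `[0, 1]`. -/
theorem norm_projBall_smul_sub_le {r : ℝ} (h0 : 0 ≤ r) (h1 : r ≤ 1) (x : E) :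
    ‖projBall (r • x) - projBall x‖ ≤ 1 - r := by
  have hx := norm_nonneg x
  by_cases hx1 : ‖x‖ ≤ 1
  · refine (norm_projBall_sub_le _ _).trans ?_
    have : r • x - x = (r - 1) • x := by rw [sub_smul, one_smul]
    rw [this, norm_smul, Real.norm_eq_abs, abs_of_nonpos (by linarith)]
    nlinarith
  · push Not at hx1
    have hn : ‖r • x‖ = r * ‖x‖ := by rw [norm_smul, Real.norm_of_nonneg h0]
    by_cases hrx : r * ‖x‖ ≤ 1
    · have : projBall (r • x) - projBall x = (r - ‖x‖⁻¹) • x := by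
        rw [projBall, projBall, hn, max_eq_left hrx, max_eq_right hx1.le, sub_smul]
        simp
      have h2 : r ≤ ‖x‖⁻¹ := by rwa [← one_div, le_div_iff₀ (by linarith)]
      rw [this, norm_smul, Real.norm_eq_abs, abs_of_nonpos (by linarith)]
      have h3 : ‖x‖⁻¹ * ‖x‖ = 1 := inv_mul_cancel₀ (by linarith)
      nlinarith
    · push Not at hrx
      have hr : 0 < r := by
        rcases h0.eq_or_lt with h | h
        · rw [← h] at hrx; linarith
        · exact h
      have : projBall (r • x) - projBall x = 0 := by
        rw [projBall, projBall, hn, max_eq_right hrx.le, max_eq_right hx1.le, smul_smul, sub_eq_zero]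
        congr 1
        have : ‖x‖ ≠ 0 := by linarith
        field_simp
      rw [this, norm_zero]
      linarith

/-- Regret of dual averaging on the unit ball with nonincreasing learning rates `(r t)⁻¹`. -/
theorem dualAveraging_regret (g : ℕ → E) {r : ℕ → ℝ} (hr : ∀ t, 0 < r t) (hmono : Monotone r)
    {u : E} (hu : ‖u‖ ≤ 1) (T : ℕ) :
    ∑ t ∈ Finset.range T,
      inner ℝ (g t) (projBall (-((r t)⁻¹ • ∑ s ∈ Finset.range t, g s)) - u) ≤
      r T / 2 + ∑ t ∈ Finset.range T, ‖g t‖ ^ 2 * (r t)⁻¹ / 2 := by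
  set θ : ℕ → E := fun t => ∑ s ∈ Finset.range t, g s with hθ
  set z : ℕ → E := fun t => projBall (-((r t)⁻¹ • θ t)) with hz
  have hz1 : ∀ t, ‖z t‖ ≤ 1 := fun t => norm_projBall_le _
  -- Quadratic growth of the strongly convex regularized objective around its minimizer `z t`,
  -- obtained from the variational inequality.
  have hmin : ∀ t (y : E), ‖y‖ ≤ 1 → inner ℝ (θ t) (z t) + r t / 2 * ‖z t‖ ^ 2 +
      r t / 2 * ‖y - z t‖ ^ 2 ≤ inner ℝ (θ t) y + r t / 2 * ‖y‖ ^ 2 := fun t y hy => by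
    have h1 := inner_sub_projBall_nonpos (-((r t)⁻¹ • θ t)) hy
    change inner ℝ (-((r t)⁻¹ • θ t) - z t) (y - z t) ≤ 0 at h1
    have h2 := mul_nonpos_of_nonneg_of_nonpos (hr t).le h1
    have hrt := (hr t).ne'
    have e : r t * inner ℝ (-((r t)⁻¹ • θ t) - z t) (y - z t) =
        -inner ℝ (θ t) (y - z t) - r t * inner ℝ (z t) (y - z t) := by
      rw [inner_sub_left, inner_neg_left, real_inner_smul_left]
      field_simp
    rw [e] at h2
    have e2 : ‖y - z t‖ ^ 2 = ‖y‖ ^ 2 - 2 * inner ℝ (z t) y + ‖z t‖ ^ 2 := by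
      rw [norm_sub_sq_real, real_inner_comm]
    rw [inner_sub_right, inner_sub_right, real_inner_self_eq_norm_sq] at h2
    rw [e2]
    linarith
  -- The minimal value of the regularized objective serves as potential; replacing `z T` by `z (T +
  -- 1)` costs one Young inequality, absorbed by the quadratic growth.
  have key : ∑ t ∈ Finset.range T, inner ℝ (g t) (z t) ≤
      inner ℝ (θ T) (z T) + r T / 2 * ‖z T‖ ^ 2 +
        ∑ t ∈ Finset.range T, ‖g t‖ ^ 2 * (r t)⁻¹ / 2 := by
    induction T with
    | zero =>
      have : 0 ≤ r 0 / 2 * ‖z 0‖ ^ 2 := by have := hr 0; positivity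
      simpa [hθ] using this
    | succ T ih =>
      rw [Finset.sum_range_succ, Finset.sum_range_succ]
      have h1 := hmin T (z (T + 1)) (hz1 _)
      have h2 : θ (T + 1) = θ T + g T := Finset.sum_range_succ _ _
      rw [h2, inner_add_left]
      have h3 : r T / 2 * ‖z (T + 1)‖ ^ 2 ≤ r (T + 1) / 2 * ‖z (T + 1)‖ ^ 2 := by
        gcongr
        exact hmono (Nat.le_succ T)
      have h4 : inner ℝ (g T) (z T) - inner ℝ (g T) (z (T + 1)) ≤
          ‖g T‖ * ‖z (T + 1) - z T‖ := by
        rw [← inner_sub_right, norm_sub_rev]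
        exact real_inner_le_norm _ _
      have h5 : ‖g T‖ * ‖z (T + 1) - z T‖ ≤
          ‖g T‖ ^ 2 * (r T)⁻¹ / 2 + r T / 2 * ‖z (T + 1) - z T‖ ^ 2 := by
        have hrT := hr T
        have : 0 ≤ r T / 2 * (‖g T‖ * (r T)⁻¹ - ‖z (T + 1) - z T‖) ^ 2 := by positivity
        have e : r T / 2 * (‖g T‖ * (r T)⁻¹ - ‖z (T + 1) - z T‖) ^ 2 =
            ‖g T‖ ^ 2 * (r T)⁻¹ / 2 + r T / 2 * ‖z (T + 1) - z T‖ ^ 2 -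
              ‖g T‖ * ‖z (T + 1) - z T‖ := by
          field_simp
          ring
        linarith
      linarith
  have hu2 := hmin T u hu
  have h6 : ∑ t ∈ Finset.range T, inner ℝ (g t) (z t - u) =
      ∑ t ∈ Finset.range T, inner ℝ (g t) (z t) - inner ℝ (θ T) u := by
    simp only [inner_sub_right, Finset.sum_sub_distrib, hθ, sum_inner]
  rw [h6]
  have h7 : 0 ≤ r T / 2 * ‖u - z T‖ ^ 2 := by have := hr T; positivity
  have h8 : r T / 2 * ‖u‖ ^ 2 ≤ r T / 2 := by
    have := hr T
    have : ‖u‖ ^ 2 ≤ 1 := pow_le_one₀ (norm_nonneg _) hu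
    nlinarith
  linarith

variable {D : ℕ} {S : ℕ → Finset ℕ} {B : ℝ}

/-- Regret of AdaDelay-Dist on the unit ball. -/
theorem BoundedDelay.adaDelayDist_regret (hS : BoundedDelay D S) {g : ℕ → E} (hB : 0 < B)
    (hg : ∀ s, ‖g s‖ ≤ B) {u : E} (hu : ‖u‖ ≤ 1) (T : ℕ) :
    ∑ t ∈ Finset.range T, inner ℝ (g t) (adaDelayDist D B S g t - u) ≤
      7 * √(lag S (fun s => ‖g s‖) T + (B * (2 * D + 1)) ^ 2) := by
  set a : ℕ → ℝ := fun s => ‖g s‖ with ha_def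
  have ha0 : ∀ s, 0 ≤ a s := fun s => norm_nonneg _
  have ha : ∀ s, a s ≤ B := hg
  set c : ℝ := (B * (2 * D + 1)) ^ 2 with hc_def
  have hD : (1 : ℝ) ≤ D := by exact_mod_cast hS.pos
  have hc : 0 < c := by positivity
  -- The ideal rate uses the full lag, which is monotone in `t`; the observed lag need not be, since
  -- the active node changes.
  set r : ℕ → ℝ := fun t => √(lag S a t + c) with hr_def
  have hrc : ∀ t, B * (2 * D + 1) ≤ r t := fun t =>
    Real.le_sqrt_of_sq_le (by have := lag_nonneg (S := S) ha0 t; simp only [hc_def] at *; linarith)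
  have hr : ∀ t, 0 < r t := fun t => lt_of_lt_of_le (by positivity) (hrc t)
  have hr2 : ∀ t, r t ^ 2 = lag S a t + c := fun t =>
    Real.sq_sqrt (by have := lag_nonneg (S := S) ha0 t; linarith)
  have hmono : Monotone r := monotone_nat_of_le_succ fun t => by
    apply Real.sqrt_le_sqrt
    have h1 : lag S a (t + 1) = lag S a t + lagTerm S a t := Finset.sum_range_succ _ _
    have := lagTerm_nonneg (S := S) ha0 t
    linarith
  set z : ℕ → E := fun t => projBall (-((r t)⁻¹ • ∑ s ∈ Finset.range t, g s)) with hz_def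
  have hdiff : ∀ t, ‖adaDelayDist D B S g t - z t‖ ≤ 3 * (∑ i ∈ missing S t, a i) * (r t)⁻¹ :=
    fun t => by
      set Γ := ∑ i ∈ missing S t, a i with hΓ
      have hΓ0 : 0 ≤ Γ := sum_nonneg_of_nonneg ha0 _
      set q := √(seenLag S a t + c) with hq
      have hseen0 : 0 ≤ seenLag S a t := Finset.sum_nonneg fun s _ =>
        add_nonneg (sq_nonneg _)
          (mul_nonneg (mul_nonneg zero_le_two (ha0 s)) (sum_nonneg_of_nonneg ha0 _))
      have hq0 : 0 < q := Real.sqrt_pos.2 (by linarith)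
      have hq2 : q ^ 2 = seenLag S a t + c := Real.sq_sqrt (by linarith)
      have hqr : q ≤ r t := Real.sqrt_le_sqrt (by have := hS.seenLag_le_lag ha0 t; linarith)
      have hrt := hr t
      set x : E := -(q⁻¹ • ∑ s ∈ S t, g s) with hx
      have e1 : adaDelayDist D B S g t = projBall x := rfl
      -- The intermediate point has the available gradients but the ideal rate, so the errors in the
      -- rate and in the sum are treated separately.
      have e2 : (q / r t) • x = -((r t)⁻¹ • ∑ s ∈ S t, g s) := by
        rw [hx, smul_neg, smul_smul]
        congr 2
        field_simp
      have h1 : ‖projBall ((q / r t) • x) - projBall x‖ ≤ 1 - q / r t :=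
        norm_projBall_smul_sub_le (by positivity) ((div_le_one hrt).2 hqr) x
      have h2 : ‖projBall ((q / r t) • x) - z t‖ ≤ Γ * (r t)⁻¹ := by
        refine (norm_projBall_sub_le _ _).trans ?_
        rw [e2, hS.sum_range_eq t]
        have : -((r t)⁻¹ • ∑ s ∈ S t, g s) -
            -((r t)⁻¹ • (∑ s ∈ S t, g s + ∑ s ∈ missing S t, g s)) =
            (r t)⁻¹ • ∑ s ∈ missing S t, g s := by
          rw [smul_add]
          abel
        rw [this, norm_smul, Real.norm_of_nonneg (by positivity), mul_comm]
        gcongr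
        exact norm_sum_le _ _
      have h3 : 1 - q / r t ≤ 2 * Γ * (r t)⁻¹ := by
        have h4 := hS.lag_sub_seenLag_le ha0 ha t
        rw [← hΓ] at h4
        have h5 : r t ^ 2 - q ^ 2 ≤ 4 * D * B * Γ := by rw [hr2, hq2]; linarith
        -- The constant `(B (2 D + 1)) ^ 2` in the rate ensures `r t ≥ 2 D B`.
        have h6 : 4 * D * B * Γ ≤ 2 * Γ * r t := by
          have := mul_le_mul_of_nonneg_left (hrc t) hΓ0
          have := mul_nonneg hΓ0 hB.le
          nlinarith
        rw [one_sub_div hrt.ne', ← div_eq_mul_inv]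
        gcongr
        have h7 : (r t - q) * r t ≤ (2 * Γ) * r t := by nlinarith
        exact le_of_mul_le_mul_right h7 hrt
      calc ‖adaDelayDist D B S g t - z t‖
          = ‖(projBall ((q / r t) • x) - z t) - (projBall ((q / r t) • x) - projBall x)‖ := by
            rw [e1]; congr 1; abel
        _ ≤ ‖projBall ((q / r t) • x) - z t‖ + ‖projBall ((q / r t) • x) - projBall x‖ :=
            norm_sub_le _ _
        _ ≤ _ := by linarith
  have h1 := dualAveraging_regret g hr hmono hu T
  have h2 : ∀ t, inner ℝ (g t) (adaDelayDist D B S g t - u) ≤ inner ℝ (g t) (z t - u) +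
      3 * a t * (∑ i ∈ missing S t, a i) * (r t)⁻¹ := fun t => by
    have e : adaDelayDist D B S g t - u = (z t - u) + (adaDelayDist D B S g t - z t) := by abel
    rw [e, inner_add_right]
    have h3 := real_inner_le_norm (g t) (adaDelayDist D B S g t - z t)
    have h4 := mul_le_mul_of_nonneg_left (hdiff t) (norm_nonneg (g t))
    have e2 : 3 * a t * (∑ i ∈ missing S t, a i) * (r t)⁻¹ =
      ‖g t‖ * (3 * (∑ i ∈ missing S t, a i) * (r t)⁻¹) := by simp only [ha_def]; ring
    linarith
  have h3 : ∀ s, lagTerm S a s ≤ c := fun s => by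
    refine (hS.lagTerm_le ha0 ha s).trans ?_
    have h4 : a s * ((2 * D - 1) * B) ≤ B * ((2 * D + 1) * B) := by
      have := ha s
      have := ha0 s
      gcongr
      · nlinarith
      · linarith
    have h5 : B * ((2 * D + 1) * B) ≤ c := by
      have : 0 ≤ B ^ 2 * ((2 * D + 1) * (2 * D)) := by positivity
      rw [hc_def]
      nlinarith
    linarith
  have h4 := sum_div_sqrt_le (fun s => lagTerm_nonneg (S := S) ha0 s) h3 hc T
  change ∑ t ∈ Finset.range T, lagTerm S a t * (r t)⁻¹ ≤ 3 * r T at h4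
  -- The cross part of `3 / 2 * lagTerm` is exactly the cost of the missing gradients.
  have h5 : ∑ t ∈ Finset.range T, (3 * a t * (∑ i ∈ missing S t, a i) * (r t)⁻¹ +
      ‖g t‖ ^ 2 * (r t)⁻¹ / 2) ≤ 3 / 2 * ∑ t ∈ Finset.range T, lagTerm S a t * (r t)⁻¹ := by
    rw [Finset.mul_sum]
    refine Finset.sum_le_sum fun t _ => ?_
    have h6 : 0 ≤ a t ^ 2 * (r t)⁻¹ := mul_nonneg (sq_nonneg _) (inv_nonneg.2 (hr t).le)
    have e : ‖g t‖ = a t := rfl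
    rw [lagTerm, e]
    nlinarith
  have h6 : ∑ t ∈ Finset.range T, inner ℝ (g t) (adaDelayDist D B S g t - u) ≤
      ∑ t ∈ Finset.range T, (inner ℝ (g t) (z t - u) +
        3 * a t * (∑ i ∈ missing S t, a i) * (r t)⁻¹) := Finset.sum_le_sum fun t _ => h2 t
  rw [Finset.sum_add_distrib] at h5 h6
  have := hr T
  linarith

end Direction

/-! ### Analytic inequalities for betting with a mixture of learning rates. -/

section Scale

theorem exp_neg_add_sq_le {x : ℝ} (hx : |x| ≤ 1 / 4) : Real.exp (-(x + x ^ 2)) ≤ 1 - x := by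
  obtain ⟨h1, h2⟩ := abs_le.1 hx
  have h3 : 1 ≤ (1 - x) * Real.exp (x + x ^ 2) := by
    rcases le_total x 0 with h | h
    · have h4 := Real.add_one_le_exp (x + x ^ 2)
      have h5 := mul_le_mul_of_nonneg_left h4 (by linarith : 0 ≤ 1 - x)
      nlinarith [mul_nonneg (neg_nonneg.2 h) (sq_nonneg x)]
    · have h4 := Real.quadratic_le_exp_of_nonneg (by positivity : 0 ≤ x + x ^ 2)
      have h5 := mul_le_mul_of_nonneg_left h4 (by linarith : 0 ≤ 1 - x)
      have h6 : 0 ≤ x ^ 2 * ((1 - x) * (1 + x) ^ 2 / 2 - x) := by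
        apply mul_nonneg (sq_nonneg x)
        nlinarith
      nlinarith
  rw [Real.exp_neg, inv_eq_one_div, div_le_iff₀ (Real.exp_pos _)]
  exact h3

/-- One step of the wealth argument: `x` is the current bet, `y` bounds the missing bets, and
`exp δ` is the error of the wealth computed from the available bets. -/
theorem mul_exp_le_one_sub_exp {x y δ : ℝ} (hx : |x| ≤ 1 / 60) (hy0 : 0 ≤ y) (hy : y ≤ 1 / 40)
    (hδ : |δ| ≤ 11 / 10 * y) :
    x * Real.exp δ ≤ 1 - Real.exp (-(x + x ^ 2 + 2 * |x| * y)) := by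
  have hx0 := abs_nonneg x
  have h1 := exp_neg_add_sq_le (hx.trans (by norm_num) : |x| ≤ 1 / 4)
  set u := 2 * |x| * y with hu
  have hu0 : 0 ≤ u := by positivity
  have hu1 : u ≤ 1 / 1000 := by rw [hu]; nlinarith
  have h2 : Real.exp (-u) ≤ 1 - u + u ^ 2 := by
    have := Real.abs_exp_sub_one_sub_id_le (x := -u) (by rw [abs_neg, abs_of_nonneg hu0]; linarith)
    have := (abs_le.1 this).2
    nlinarith
  have h3 : |Real.exp δ - 1| ≤ 6 / 5 * y := by
    have h4 := Real.abs_exp_sub_one_sub_id_le (x := δ) (by linarith)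
    have h5 : |Real.exp δ - 1| ≤ |Real.exp δ - 1 - δ| + |δ| := by
      have := abs_add_le (Real.exp δ - 1 - δ) δ
      simpa using this
    have h6 : δ ^ 2 ≤ (11 / 10 * y) ^ 2 := by
      rw [← sq_abs]
      gcongr
    nlinarith
  have h7 : x * (Real.exp δ - 1) ≤ |x| * (6 / 5 * y) :=
    (le_abs_self _).trans (by rw [abs_mul]; gcongr)
  have h8 : Real.exp (-(x + x ^ 2 + u)) ≤ (1 - x) * (1 - u + u ^ 2) := by
    rw [neg_add, Real.exp_add]
    have := abs_le.1 hx
    gcongr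
    linarith
  have h9 : (1 - x) * (1 - u + u ^ 2) ≤ 1 - x - 9 / 10 * u := by
    have h10 := abs_le.1 hx
    have h11 : 59 / 60 * (999 / 1000) ≤ (1 - x) * (1 - u) := by
      apply mul_le_mul <;> linarith
    have h12 := mul_le_mul_of_nonneg_right h11 hu0
    nlinarith
  -- Stale wealth costs at most `3 / 5 * u`, while the correction `u` in the exponent gains at least
  -- `9 / 10 * u`.
  have h13 : |x| * (6 / 5 * y) = 3 / 5 * u := by rw [hu]; ring
  linarith

/-- The normalizing constant of the prior on learning rates. -/
noncomputable def priorMass (A : ℝ) : ℝ := ∫ η in (0 : ℝ)..A, Real.exp (-η ^ 2)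

theorem continuous_exp_neg_sq : Continuous fun η : ℝ => Real.exp (-η ^ 2) := by fun_prop

theorem priorMass_pos {A : ℝ} (hA : 0 < A) : 0 < priorMass A :=
  intervalIntegral.intervalIntegral_pos_of_pos (continuous_exp_neg_sq.intervalIntegrable _ _)
    (fun _ => Real.exp_pos _) hA

theorem priorMass_le_self {A : ℝ} (hA : 0 < A) : priorMass A ≤ A := by
  have h : priorMass A ≤ ∫ _ in (0 : ℝ)..A, (1 : ℝ) :=
    intervalIntegral.integral_mono_on hA.le (continuous_exp_neg_sq.intervalIntegrable _ _)
      (continuous_const.intervalIntegrable _ _) fun x _ =>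
        Real.exp_le_one_iff.2 (neg_nonpos.2 (sq_nonneg x))
  simpa using h

/-- The half-line Gaussian integral is `√π / 2 ≤ 1`. Unlike the bound by `A`, this one survives when
`A` is large. -/
theorem priorMass_le_one {A : ℝ} (hA : 0 < A) : priorMass A ≤ 1 := by
  have hi : MeasureTheory.Integrable fun x : ℝ => Real.exp (-x ^ 2) := by
    simpa using integrable_exp_neg_mul_sq (b := 1) one_pos
  have h : priorMass A ≤ ∫ x in Set.Ioi (0 : ℝ), Real.exp (-x ^ 2) := by
    rw [priorMass, intervalIntegral.integral_of_le hA.le]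
    exact MeasureTheory.setIntegral_mono_set hi.integrableOn
      (Filter.Eventually.of_forall fun x => (Real.exp_pos _).le)
      Set.Ioc_subset_Ioi_self.eventuallyLE
  have h2 := integral_gaussian_Ioi 1
  simp only [neg_mul, one_mul, div_one] at h2
  rw [h2] at h
  have h3 : √Real.pi ≤ 2 := Real.sqrt_le_iff.2 ⟨by norm_num, by linarith [Real.pi_le_four]⟩
  linarith

/-- A lower bound for the Gaussian-type integral that controls the wealth. -/
theorem mul_exp_le_integral {A R W η : ℝ} (hη : 0 < η) (hηA : η ≤ A) (hR : η * W ≤ R / 2)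
    (hR0 : 0 ≤ R) (hW : 0 ≤ W) :
    η / 2 * Real.exp (η * R / 4) ≤ ∫ x in (0 : ℝ)..A, Real.exp (x * R - x ^ 2 * W) := by
  have hc : Continuous fun x : ℝ => Real.exp (x * R - x ^ 2 * W) := by fun_prop
  have h1 : ∫ x in (η / 2)..η, Real.exp (x * R - x ^ 2 * W) ≤
      ∫ x in (0 : ℝ)..A, Real.exp (x * R - x ^ 2 * W) :=
    intervalIntegral.integral_mono_interval (by linarith) (by linarith) hηA
      (Filter.Eventually.of_forall fun x => (Real.exp_pos _).le) (hc.intervalIntegrable _ _)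
  have h2 : ∫ _ in (η / 2)..η, Real.exp (η * R / 4) ≤
      ∫ x in (η / 2)..η, Real.exp (x * R - x ^ 2 * W) := by
    refine intervalIntegral.integral_mono_on (by linarith) (continuous_const.intervalIntegrable _ _)
      (hc.intervalIntegrable _ _) fun x hx => Real.exp_le_exp.2 ?_
    have h3 : x * W ≤ η * W := by gcongr; exact hx.2
    have h4 : x * (R / 2) ≤ x * (R - x * W) :=
      mul_le_mul_of_nonneg_left (by linarith) (by linarith [hx.1])
    have h5 : η / 2 * (R / 2) ≤ x * (R / 2) := by gcongr; exact hx.1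
    nlinarith
  rw [intervalIntegral.integral_const, smul_eq_mul] at h2
  have e : η - η / 2 = η / 2 := by ring
  rw [e] at h2
  exact h2.trans h1

theorem two_pow_le_exp {n : ℕ} {x : ℝ} (h : (n : ℝ) ≤ x) : (2 : ℝ) ^ n ≤ Real.exp x := by
  have h1 : (2 : ℝ) ≤ Real.exp 1 := by have := Real.add_one_le_exp 1; linarith
  calc (2 : ℝ) ^ n ≤ Real.exp 1 ^ n := by gcongr
    _ = Real.exp n := by rw [← Real.exp_nat_mul, mul_one]
    _ ≤ _ := Real.exp_le_exp.2 h

/-- The trade-off between the comparator term and the wealth, in both regimes of the optimal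
learning rate. -/
theorem scale_tradeoff {A R Λ U ν K : ℝ} (hA : 0 < A) (hΛ : 0 ≤ Λ) (hU : 0 ≤ U) (hν : 0 < ν)
    (hK : 1 ≤ K) (hAK : A⁻¹ ≤ 120 * K) (hΛK : Λ * A ≤ K) :
    U * R - ν * ((∫ x in (0 : ℝ)..A, Real.exp (x * R - x ^ 2 * (1 + Λ))) / priorMass A) ≤
      U * (5 * √((1 + Λ) * (1 + Real.log (1 + U * K / ν))) +
        88 * (1 + Real.log (1 + U * K / ν)) / A) := by
  set L := 1 + Real.log (1 + U * K / ν) with hL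
  set J := ∫ x in (0 : ℝ)..A, Real.exp (x * R - x ^ 2 * (1 + Λ)) with hJ
  set W := 1 + Λ with hW
  have hW1 : 1 ≤ W := by linarith
  have hq : 0 ≤ U * K / ν := by positivity
  have hlog : 0 ≤ Real.log (1 + U * K / ν) := Real.log_nonneg (by linarith)
  have hL1 : 1 ≤ L := by linarith
  have hZ := priorMass_pos hA
  have hJ0 : 0 ≤ J := intervalIntegral.integral_nonneg hA.le fun x _ => (Real.exp_pos _).le
  -- Below the threshold the wealth is discarded; above it the wealth alone pays for `U * R`. The
  -- `1` in `W` comes from the density `exp (-η²)`.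
  by_cases hthr : R ≤ 5 * √(W * L) + 88 * L / A
  · have h1 : U * R ≤ U * (5 * √(W * L) + 88 * L / A) := by gcongr
    have h2 : 0 ≤ ν * (J / priorMass A) := by positivity
    linarith
  · push Not at hthr
    have hs0 : 0 ≤ √(W * L) := Real.sqrt_nonneg _
    have ht0 : 0 ≤ 88 * L / A := by positivity
    have hR0 : 0 < R := by linarith
    suffices h : U * R ≤ ν * (J / priorMass A) by
      have : 0 ≤ U * (5 * √(W * L) + 88 * L / A) := by positivity
      linarith
    rcases le_total A (R / (2 * W)) with hcase | hcase
    · -- the optimal learning rate is the largest one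
      have h1 : A / 2 * Real.exp (A * R / 4) ≤ J :=
        mul_exp_le_integral hA le_rfl
          (by rw [le_div_iff₀ (by positivity)] at hcase; linarith) hR0.le (by linarith)
      set x := A * R / 4 with hx
      -- `88 = 4 * 22`. One factor `exp (x / 2)` absorbs the linear `x` in `U * R`; the other is at
      -- least `2 ^ 11 * (U * K / ν)`, enough to beat the `480` coming from `A⁻¹ ≤ 120 * K`.
      have hx22 : 22 * L ≤ x := by
        have : 88 * L / A ≤ R := by linarith
        rw [div_le_iff₀ hA] at this
        rw [hx]
        linarith
      have h2 : Real.exp x / 2 ≤ J / priorMass A := by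
        rw [le_div_iff₀ hZ]
        have := priorMass_le_self hA
        have := Real.exp_pos x
        nlinarith
      have h3 : Real.exp x = Real.exp (x / 2) * Real.exp (x / 2) := by
        rw [← Real.exp_add]; congr 1; ring
      have h4 : x / 2 ≤ Real.exp (x / 2) := by have := Real.add_one_le_exp (x / 2); linarith
      have h5 : 2048 * (U * K / ν) ≤ Real.exp (x / 2) := by
        have e : x / 2 = (x / 2 - Real.log (1 + U * K / ν)) + Real.log (1 + U * K / ν) := by ring
        have h6 : (2 : ℝ) ^ 11 ≤ Real.exp (x / 2 - Real.log (1 + U * K / ν)) :=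
          two_pow_le_exp (by push_cast; linarith)
        rw [e, Real.exp_add, Real.exp_log (by linarith)]
        nlinarith
      have h10 : R = 4 * x / A := by rw [hx]; field_simp
      have h11 : U * R ≤ ν * (Real.exp x / 2) := by
        have h12 : U * R ≤ 480 * x * (U * K) := by
          rw [h10, div_eq_mul_inv]
          have : 0 ≤ x * U := by have : 0 ≤ x := by linarith
                                 positivity
          nlinarith
        have h13 : U * K = ν * (U * K / ν) := by field_simp
        have h14 : 2048 * (U * K / ν) * (x / 2) ≤ Real.exp x := by
          rw [h3]; gcongr
        have h15 := mul_le_mul_of_nonneg_left h14 hν.le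
        rw [h13] at h12
        have : 0 ≤ x * (ν * (U * K / ν)) := by have : 0 ≤ x := by linarith
                                               positivity
        nlinarith
      exact h11.trans (by gcongr)
    · -- the optimal learning rate is in the interior
      set η := R / (2 * W) with hη
      have hη0 : 0 < η := by positivity
      have h1 : η / 2 * Real.exp (η * R / 4) ≤ J :=
        mul_exp_le_integral hη0 hcase (by rw [hη]; field_simp; rfl) hR0.le (by linarith)
      have h2 : η * R / 4 = R ^ 2 / (8 * W) := by rw [hη]; field_simp; ring
      -- The threshold constant `5` gives `25 / 8 ≥ 3`.
      have h3 : 3 * L ≤ η * R / 4 := by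
        rw [h2, le_div_iff₀ (by positivity)]
        have h4 : (5 * √(W * L)) ^ 2 ≤ R ^ 2 := by gcongr; linarith
        rw [mul_pow, Real.sq_sqrt (by positivity)] at h4
        nlinarith
      have h4 : 8 * (U * K / ν) ≤ Real.exp (η * R / 4) := by
        refine le_trans ?_ (Real.exp_le_exp.2 h3)
        have e : 3 * L = 2 * L + 1 + Real.log (1 + U * K / ν) := by rw [hL]; ring
        have h5 := two_pow_le_exp (n := 3) (x := 2 * L + 1) (by push_cast; linarith)
        rw [e, Real.exp_add, Real.exp_log (by linarith)]
        nlinarith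
      -- The mass is bounded by `1` against the `1` in `W`, and by `A` against `Λ`.
      have h5 : W * priorMass A ≤ 2 * K := by
        have := priorMass_le_self hA
        have := priorMass_le_one hA
        have : Λ * priorMass A ≤ Λ * A := by gcongr
        rw [hW]
        linarith
      have h6 : U * R * priorMass A ≤ ν * J := by
        calc U * R * priorMass A = U * (2 * η) * (W * priorMass A) := by rw [hη]; field_simp
          _ ≤ U * (2 * η) * (2 * K) := by gcongr
          _ = ν * (η / 2 * (8 * (U * K / ν))) := by field_simp; ring
          _ ≤ ν * (η / 2 * Real.exp (η * R / 4)) := by gcongr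
          _ ≤ ν * J := by gcongr
      rw [← mul_div_assoc, le_div_iff₀ hZ]
      exact h6

end Scale

/-! ### Regret of the scale by the wealth argument. -/

section ScaleRegret

/-- The wealth of the bettor with fraction `η`, with full information on the first `t` rounds. -/
noncomputable def wealth (S : ℕ → Finset ℕ) (ν : ℝ) (h : ℕ → ℝ) (t : ℕ) (η : ℝ) : ℝ :=
  ν * Real.exp (-(η * ∑ s ∈ Finset.range t, h s + η ^ 2 * lag S (fun s => |h s|) t))

/-- The wealth computed from the rounds available in round `t`. -/
noncomputable def seenWealth (S : ℕ → Finset ℕ) (ν : ℝ) (h : ℕ → ℝ) (t : ℕ) (η : ℝ) : ℝ :=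
  ν * Real.exp (-(η * ∑ s ∈ S t, h s + η ^ 2 * seenLag S (fun s => |h s|) t))

variable {D : ℕ} {S : ℕ → Finset ℕ} {B ν : ℝ} {h : ℕ → ℝ}

theorem continuous_wealth (t : ℕ) : Continuous (wealth S ν h t) := by
  unfold wealth
  fun_prop

theorem continuous_seenWealth (t : ℕ) : Continuous (seenWealth S ν h t) := by
  unfold seenWealth
  fun_prop

theorem scaleAlg_eq (t : ℕ) : scaleAlg D B 0 ν S h t =
    (∫ η in (0 : ℝ)..etaMax D B 0, seenWealth S ν h t η * η * Real.exp (-η ^ 2)) /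
      priorMass (etaMax D B 0) := by
  unfold scaleAlg priorMass
  congr 1
  refine intervalIntegral.integral_congr fun η _ => ?_
  simp only [seenWealth, seenLag, zetaHat, add_zero]
  congr 5
  rw [Finset.mul_sum, Finset.mul_sum, ← Finset.sum_add_distrib]
  refine Finset.sum_congr rfl fun s _ => ?_
  rw [sq_abs]
  ring

/-- The observed wealth is the true one times `exp δ`, where `δ` collects the missing losses and the
unobserved lag, hence is at most `11 / 10` of `η` times the missing mass. The lag in the exponent
covers this error, so the bets telescope. -/
theorem BoundedDelay.seenWealth_mul_le (hS : BoundedDelay D S) (hB : 0 < B) (hν : 0 < ν)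
    (hh : ∀ s, |h s| ≤ B) (t : ℕ) {η : ℝ} (hη0 : 0 ≤ η) (hη : η ≤ etaMax D B 0) :
    seenWealth S ν h t η * η * h t ≤ wealth S ν h t η - wealth S ν h (t + 1) η := by
  have hD : (1 : ℝ) ≤ D := by exact_mod_cast hS.pos
  set a : ℕ → ℝ := fun s => |h s| with ha_def
  have ha0 : ∀ s, 0 ≤ a s := fun s => abs_nonneg _
  set Γ := ∑ i ∈ missing S t, a i with hΓ
  have hΓ0 : 0 ≤ Γ := sum_nonneg_of_nonneg ha0 _
  -- The factor `20` in `etaMax` supplies the smallness `1 / 60` and `1 / 40` required by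
  -- `mul_exp_le_one_sub_exp`.
  have hηB : η * (B * 20 * (1 + 2 * D)) ≤ 1 := by
    rw [etaMax, add_zero] at hη
    rwa [← le_div_iff₀ (by positivity), one_div]
  have hηB' : 0 ≤ η * B := by positivity
  have hηBD : η * B * D ≤ 1 / 40 := by nlinarith
  have hηB1 : η * B ≤ 1 / 60 := by nlinarith
  set δ := η * ∑ i ∈ missing S t, h i + η ^ 2 * (lag S a t - seenLag S a t) with hδ_def
  have hx : |η * h t| ≤ 1 / 60 := by
    rw [abs_mul, abs_of_nonneg hη0]
    exact (mul_le_mul_of_nonneg_left (hh t) hη0).trans hηB1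
  have hy : η * Γ ≤ 1 / 40 := by
    have h1 := mul_le_mul_of_nonneg_left (hS.sum_missing_le (a := a) hh t hB.le) hη0
    rw [← hΓ] at h1
    nlinarith
  have hδ : |δ| ≤ 11 / 10 * (η * Γ) := by
    have h1 : |η * ∑ i ∈ missing S t, h i| ≤ η * Γ := by
      rw [abs_mul, abs_of_nonneg hη0]
      gcongr
      exact Finset.abs_sum_le_sum_abs _ _
    have h2 : 0 ≤ η ^ 2 * (lag S a t - seenLag S a t) :=
      mul_nonneg (sq_nonneg _) (sub_nonneg.2 (hS.seenLag_le_lag ha0 t))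
    have h3 : η ^ 2 * (lag S a t - seenLag S a t) ≤ 1 / 10 * (η * Γ) := by
      have h4 := mul_le_mul_of_nonneg_left (hS.lag_sub_seenLag_le ha0 hh t) (sq_nonneg η)
      have h5 := mul_le_mul_of_nonneg_right hηBD (mul_nonneg hη0 hΓ0)
      rw [← hΓ] at h4
      nlinarith
    have h4 := abs_add_le (η * ∑ i ∈ missing S t, h i) (η ^ 2 * (lag S a t - seenLag S a t))
    rw [abs_of_nonneg h2] at h4
    rw [hδ_def]
    linarith
  have key := mul_exp_le_one_sub_exp hx (by positivity) hy hδ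
  have e1 : seenWealth S ν h t η = wealth S ν h t η * Real.exp δ := by
    rw [seenWealth, wealth, mul_assoc, ← Real.exp_add, hδ_def, hS.sum_range_eq t]
    congr 2
    ring
  have e2 : wealth S ν h (t + 1) η = wealth S ν h t η *
      Real.exp (-(η * h t + (η * h t) ^ 2 + 2 * |η * h t| * (η * Γ))) := by
    rw [wealth, wealth, mul_assoc, ← Real.exp_add, Finset.sum_range_succ]
    have : lag S (fun s => |h s|) (t + 1) = lag S (fun s => |h s|) t + lagTerm S a t :=
      Finset.sum_range_succ _ _
    rw [this, lagTerm, abs_mul, abs_of_nonneg hη0, ← sq_abs (η * h t), abs_mul, abs_of_nonneg hη0]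
    congr 2
    rw [← hΓ]
    ring
  have hw : 0 < wealth S ν h t η := mul_pos hν (Real.exp_pos _)
  rw [e1, e2]
  have := mul_le_mul_of_nonneg_left key hw.le
  linarith

/-- Regret of the scale algorithm at the origin, with the remaining wealth. -/
theorem BoundedDelay.sum_scaleAlg_mul_le (hS : BoundedDelay D S) (hB : 0 < B) (hν : 0 < ν)
    (hh : ∀ s, |h s| ≤ B) (T : ℕ) :
    ∑ t ∈ Finset.range T, scaleAlg D B 0 ν S h t * h t ≤
      ν - (∫ η in (0 : ℝ)..etaMax D B 0, wealth S ν h T η * Real.exp (-η ^ 2)) /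
        priorMass (etaMax D B 0) := by
  set A := etaMax D B 0 with hA_def
  have hA : 0 < A := by
    rw [hA_def, etaMax, add_zero]
    positivity
  have hZ := priorMass_pos hA
  have hc := continuous_exp_neg_sq
  induction T with
  | zero =>
    have : ∫ η in (0 : ℝ)..A, wealth S ν h 0 η * Real.exp (-η ^ 2) = ν * priorMass A := by
      simp [wealth, lag, priorMass]
    rw [this, mul_div_cancel_right₀ _ hZ.ne']
    simp
  | succ T ih =>
    rw [Finset.sum_range_succ]
    have hw : ∀ t, IntervalIntegrable (fun η => wealth S ν h t η * Real.exp (-η ^ 2))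
        MeasureTheory.volume 0 A := fun t =>
      ((continuous_wealth t).mul hc).intervalIntegrable _ _
    have h1 : (∫ η in (0 : ℝ)..A, seenWealth S ν h T η * η * Real.exp (-η ^ 2)) * h T ≤
        (∫ η in (0 : ℝ)..A, wealth S ν h T η * Real.exp (-η ^ 2)) -
          ∫ η in (0 : ℝ)..A, wealth S ν h (T + 1) η * Real.exp (-η ^ 2) := by
      rw [← intervalIntegral.integral_sub (hw T) (hw (T + 1)),
        ← intervalIntegral.integral_mul_const]
      refine intervalIntegral.integral_mono_on hA.le
        (((((continuous_seenWealth T).mul continuous_id).mul hc).mul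
          continuous_const).intervalIntegrable _ _) ((hw T).sub (hw (T + 1))) fun η hη => ?_
      have h2 := mul_le_mul_of_nonneg_right
        (hS.seenWealth_mul_le hB hν hh T hη.1 hη.2) (Real.exp_pos (-η ^ 2)).le
      linarith
    have h2 : scaleAlg D B 0 ν S h T * h T ≤
        (∫ η in (0 : ℝ)..A, wealth S ν h T η * Real.exp (-η ^ 2)) / priorMass A -
          (∫ η in (0 : ℝ)..A, wealth S ν h (T + 1) η * Real.exp (-η ^ 2)) / priorMass A := by
      rw [scaleAlg_eq, div_mul_eq_mul_div, ← sub_div]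
      gcongr
    linarith

/-- Regret of the scale algorithm. -/
theorem BoundedDelay.scaleAlg_regret (hS : BoundedDelay D S) (hB : 0 < B) (hν : 0 < ν)
    (hh : ∀ s, |h s| ≤ B) {U K : ℝ} (hU : 0 ≤ U) (hK : 1 ≤ K)
    (hBK : B * 20 * (1 + 2 * D) ≤ 120 * K) (T : ℕ)
    (hΛK : lag S (fun s => |h s|) T ≤ K * (B * 20 * (1 + 2 * D))) :
    ∑ t ∈ Finset.range T, (scaleAlg D B 0 ν S h t - U) * h t ≤
      ν + U * (5 * √((1 + lag S (fun s => |h s|) T) * (1 + Real.log (1 + U * K / ν))) +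
        88 * (1 + Real.log (1 + U * K / ν)) * (B * 20 * (1 + 2 * D))) := by
  have h1 := hS.sum_scaleAlg_mul_le hB hν hh T
  have hA : etaMax D B 0 = (B * 20 * (1 + 2 * D))⁻¹ := by rw [etaMax, add_zero]
  set A := etaMax D B 0 with hA_def
  have hp : 0 < B * 20 * (1 + 2 * (D : ℝ)) := by positivity
  have hA0 : 0 < A := by rw [hA]; positivity
  have hAinv : A⁻¹ = B * 20 * (1 + 2 * D) := by rw [hA, inv_inv]
  have hΛ0 : 0 ≤ lag S (fun s => |h s|) T := lag_nonneg (fun s => abs_nonneg _) T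
  have h2 := scale_tradeoff (R := -∑ s ∈ Finset.range T, h s) hA0 hΛ0 hU hν hK
    (by rw [hAinv]; exact hBK) (by rw [hA, ← div_eq_mul_inv, div_le_iff₀ hp]; exact hΛK)
  rw [div_eq_mul_inv _ A, hAinv] at h2
  have h3 : ∫ η in (0 : ℝ)..A, wealth S ν h T η * Real.exp (-η ^ 2) =
      ν * ∫ x in (0 : ℝ)..A, Real.exp (x * (-∑ s ∈ Finset.range T, h s) -
        x ^ 2 * (1 + lag S (fun s => |h s|) T)) := by
    rw [← intervalIntegral.integral_const_mul]
    refine intervalIntegral.integral_congr fun x _ => ?_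
    simp only [wealth]
    rw [mul_assoc, ← Real.exp_add]
    congr 2
    ring
  rw [h3, mul_div_assoc] at h1
  simp only [sub_mul, Finset.sum_sub_distrib, ← Finset.mul_sum]
  linarith

end ScaleRegret

/-! ### Combination of scale and direction. -/

section Combined

variable {E : Type*} [NormedAddCommGroup E] [InnerProductSpace ℝ E]
variable {D : ℕ} {S : ℕ → Finset ℕ} {B ν : ℝ}

/-- Pathwise regret of the black-box reduction for linear losses. -/
theorem BoundedDelay.blackBox_regret (hS : BoundedDelay D S) {g : ℕ → E} (hB : 0 < B) (hν : 0 < ν)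
    (hg : ∀ s, ‖g s‖ ≤ B) (u : E) {K : ℝ} (hK : 1 ≤ K) (hBK : B * 20 * (1 + 2 * D) ≤ 120 * K)
    (T : ℕ) (hΛK : lag S (fun s => ‖g s‖) T ≤ K * (B * 20 * (1 + 2 * D))) :
    ∑ t ∈ Finset.range T,
      inner ℝ (g t) (blackBox (adaDelayDist D B S) (scaleAlg D B 0 ν S) g t - u) ≤
      ν + ‖u‖ * (12 * √((1 + lag S (fun s => ‖g s‖) T) * (1 + Real.log (1 + ‖u‖ * K / ν))) +
        1767 * (B * (1 + 2 * D)) * (1 + Real.log (1 + ‖u‖ * K / ν))) := by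
  set z := adaDelayDist D B S g with hz
  set h : ℕ → ℝ := fun s => inner ℝ (z s) (g s) with hh_def
  set Λ := lag S (fun s => ‖g s‖) T with hΛ
  set L := 1 + Real.log (1 + ‖u‖ * K / ν) with hL
  have hL1 : 1 ≤ L := by
    have : 0 ≤ ‖u‖ * K / ν := by positivity
    have := Real.log_nonneg (by linarith : 1 ≤ 1 + ‖u‖ * K / ν)
    linarith
  have hhg : ∀ s, |h s| ≤ ‖g s‖ := fun s => by
    refine (abs_real_inner_le_norm _ _).trans ?_
    have h1 : ‖z s‖ ≤ 1 := norm_projBall_le _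
    have := mul_le_mul_of_nonneg_right h1 (norm_nonneg (g s))
    linarith
  have hΛh : lag S (fun s => |h s|) T ≤ Λ := lag_mono_right (fun s => abs_nonneg _) hhg T
  have hΛ0 : 0 ≤ Λ := lag_nonneg (fun s => norm_nonneg _) T
  have h1 := hS.scaleAlg_regret hB hν (fun s => (hhg s).trans (hg s)) (norm_nonneg u) hK hBK T
    (hΛh.trans hΛK)
  obtain ⟨u', hu', hu⟩ : ∃ u' : E, ‖u'‖ ≤ 1 ∧ u = ‖u‖ • u' := by
    by_cases h0 : u = 0
    · exact ⟨0, by simp, by simp [h0]⟩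
    · have : ‖u‖ ≠ 0 := norm_ne_zero_iff.2 h0
      refine ⟨‖u‖⁻¹ • u, ?_, ?_⟩
      · rw [norm_smul, norm_inv, norm_norm, inv_mul_cancel₀ this]
      · rw [smul_smul, mul_inv_cancel₀ this, one_smul]
  have h2 := hS.adaDelayDist_regret hB hg hu' T
  have h3 : ∀ t, inner ℝ (g t) (blackBox (adaDelayDist D B S) (scaleAlg D B 0 ν S) g t - u) =
      (scaleAlg D B 0 ν S h t - ‖u‖) * h t + ‖u‖ * inner ℝ (g t) (z t - u') := fun t => by
    have e : blackBox (adaDelayDist D B S) (scaleAlg D B 0 ν S) g t =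
      scaleAlg D B 0 ν S h t • z t := rfl
    rw [e]
    conv_lhs => rw [hu]
    simp only [hh_def, inner_sub_right, real_inner_smul_right, real_inner_comm (g t) (z t)]
    ring
  rw [Finset.sum_congr rfl fun t _ => h3 t, Finset.sum_add_distrib, ← Finset.mul_sum]
  have h4 : √((1 + lag S (fun s => |h s|) T) * L) ≤ √((1 + Λ) * L) := by gcongr
  have h5 : √(Λ + (B * (2 * D + 1)) ^ 2) ≤ √((1 + Λ) * L) + B * (1 + 2 * D) * L := by
    have hp : 0 ≤ B * (1 + 2 * (D : ℝ)) := by positivity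
    rw [Real.sqrt_le_left (by positivity)]
    have h6 : √((1 + Λ) * L) ^ 2 = (1 + Λ) * L := Real.sq_sqrt (by positivity)
    have h7 : 0 ≤ √((1 + Λ) * L) * (B * (1 + 2 * D) * L) := by positivity
    have h8 : (B * (2 * D + 1)) ^ 2 ≤ (B * (1 + 2 * D) * L) ^ 2 := by
      have e : B * (2 * (D : ℝ) + 1) = B * (1 + 2 * D) * 1 := by ring
      rw [e]
      gcongr
    nlinarith
  have h6 := mul_le_mul_of_nonneg_left h2 (norm_nonneg u)
  have h7 := mul_le_mul_of_nonneg_left h4 (norm_nonneg u)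
  have h8 := mul_le_mul_of_nonneg_left h5 (norm_nonneg u)
  -- Constants: `12 = 5 + 7` and `1767 = 88 * 20 + 7`, from scale and direction.
  linarith

end Combined

/-! ### Predictions depend on the past only. -/

section Causality

variable {E : Type*} [NormedAddCommGroup E] [InnerProductSpace ℝ E]
variable {D : ℕ} {S S' : ℕ → Finset ℕ} {B ε ν : ℝ} {t : ℕ}

theorem missingSeen_congr (hSS : ∀ s ≤ t, S s = S' s) {s : ℕ} (hs : s ≤ t) :
    missingSeen S t s = missingSeen S' t s := by
  simp only [missingSeen, missing, hSS s hs, hSS t le_rfl]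

theorem adaDelayDist_congr (hS : S t ⊆ Finset.range t) (hSS : ∀ s ≤ t, S s = S' s) {g g' : ℕ → E}
    (hgg : ∀ s < t, g s = g' s) : adaDelayDist D B S g t = adaDelayDist D B S' g' t := by
  have hlt : ∀ s ∈ S t, s < t := fun s hs => Finset.mem_range.1 (hS hs)
  have h1 : observedLag S g t = observedLag S' g' t := by
    unfold observedLag
    rw [← hSS t le_rfl]
    refine Finset.sum_congr rfl fun s hs => ?_
    rw [hgg s (hlt s hs), ← missingSeen_congr hSS (hlt s hs).le]
    congr 2
    exact Finset.sum_congr rfl fun i hi => by rw [hgg i (hlt i (Finset.mem_inter.1 hi).2)]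
  have h2 : ∑ s ∈ S t, g s = ∑ s ∈ S' t, g' s := by
    rw [← hSS t le_rfl]
    exact Finset.sum_congr rfl fun s hs => hgg s (hlt s hs)
  unfold adaDelayDist adaRate
  rw [h1, h2]

theorem scaleAlg_congr (hS : S t ⊆ Finset.range t) (hSS : ∀ s ≤ t, S s = S' s) {h h' : ℕ → ℝ}
    (hhh : ∀ s < t, h s = h' s) : scaleAlg D B ε ν S h t = scaleAlg D B ε ν S' h' t := by
  have hlt : ∀ s ∈ S t, s < t := fun s hs => Finset.mem_range.1 (hS hs)
  unfold scaleAlg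
  congr 1
  refine intervalIntegral.integral_congr fun η _ => ?_
  congr 5
  rw [← hSS t le_rfl]
  refine Finset.sum_congr rfl fun s hs => ?_
  have : zetaHat ε S h t s = zetaHat ε S' h' t s := by
    unfold zetaHat
    rw [hhh s (hlt s hs), ← missingSeen_congr hSS (hlt s hs).le]
    congr 1
    exact Finset.sum_congr rfl fun i hi => by rw [hhh i (hlt i (Finset.mem_inter.1 hi).2)]
  rw [this, hhh s (hlt s hs)]

/-- The scale is fed with `⟪z_s, g_s⟫` for `s < t`, so the earlier directions must agree as well.
This lets the predictions made along growing histories be read as a single run. -/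
theorem blackBox_congr (hS : ∀ s, S s ⊆ Finset.range s) (hSS : ∀ s ≤ t, S s = S' s) {g g' : ℕ → E}
    (hgg : ∀ s < t, g s = g' s) :
    blackBox (adaDelayDist D B S) (scaleAlg D B ε ν S) g t =
      blackBox (adaDelayDist D B S') (scaleAlg D B ε ν S') g' t := by
  have h1 : ∀ s ≤ t, adaDelayDist D B S g s = adaDelayDist D B S' g' s := fun s hs =>
    adaDelayDist_congr (hS s) (fun r hr => hSS r (hr.trans hs)) fun r hr => hgg r (hr.trans_le hs)
  unfold blackBox
  rw [h1 t le_rfl]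
  congr 1
  exact scaleAlg_congr (hS t) hSS fun s hs => by rw [h1 s hs.le, hgg s hs]

end Causality

/-! ### Expectations under finitely supported laws. -/

section Expectation

/-- The expectation of a real function under a discrete law. -/
noncomputable def expect {α : Type*} (p : PMF α) (f : α → ℝ) : ℝ := ∑' a, (p a).toReal * f a

variable {α β : Type*} {p : PMF α}

theorem expect_eq_sum (p : PMF α) (f : α → ℝ) {s : Finset α} (hs : p.support ⊆ s) :
    expect p f = ∑ a ∈ s, (p a).toReal * f a :=
  tsum_eq_sum fun a ha => by
    have : p a = 0 := by
      by_contra h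
      exact ha (hs ((p.mem_support_iff a).2 h))
    simp [this]

theorem expect_fintype [Fintype α] (p : PMF α) (f : α → ℝ) :
    expect p f = ∑ a, (p a).toReal * f a := expect_eq_sum p f (by simp)

theorem expect_const (hp : p.support.Finite) (c : ℝ) : expect p (fun _ => c) = c := by
  rw [expect_eq_sum p _ (s := hp.toFinset) (by simp), ← Finset.sum_mul,
    ← ENNReal.toReal_sum fun a _ => p.apply_ne_top a]
  have h : ∑ a ∈ hp.toFinset, p a = 1 := by
    rw [← p.tsum_coe]
    exact (tsum_eq_sum fun a ha => by
      by_contra h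
      exact ha (hp.mem_toFinset.2 ((p.mem_support_iff a).2 h))).symm
  simp [h]

theorem expect_add (hp : p.support.Finite) (f g : α → ℝ) :
    expect p (fun a => f a + g a) = expect p f + expect p g := by
  simp only [expect_eq_sum p _ (s := hp.toFinset) (by simp), mul_add, Finset.sum_add_distrib]

theorem expect_const_mul (p : PMF α) (c : ℝ) (f : α → ℝ) :
    expect p (fun a => c * f a) = c * expect p f := by
  unfold expect
  rw [← tsum_mul_left]
  exact tsum_congr fun a => by ring

theorem expect_mul_const (p : PMF α) (c : ℝ) (f : α → ℝ) :
    expect p (fun a => f a * c) = expect p f * c := by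
  simp only [mul_comm _ c, expect_const_mul]

theorem expect_sum (hp : p.support.Finite) {ι : Type*} (s : Finset ι) (f : ι → α → ℝ) :
    expect p (fun a => ∑ i ∈ s, f i a) = ∑ i ∈ s, expect p (f i) := by
  simp only [expect_eq_sum p _ (s := hp.toFinset) (by simp), Finset.mul_sum]
  exact Finset.sum_comm

theorem expect_mono (hp : p.support.Finite) {f g : α → ℝ} (h : ∀ a ∈ p.support, f a ≤ g a) :
    expect p f ≤ expect p g := by
  simp only [expect_eq_sum p _ (s := hp.toFinset) (by simp)]
  refine Finset.sum_le_sum fun a ha => ?_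
  have := h a (hp.mem_toFinset.1 ha)
  gcongr

theorem expect_congr (p : PMF α) {f g : α → ℝ} (h : ∀ a ∈ p.support, f a = g a) :
    expect p f = expect p g :=
  tsum_congr fun a => by
    by_cases ha : a ∈ p.support
    · rw [h a ha]
    · have : p a = 0 := by_contra fun h' => ha ((p.mem_support_iff a).2 h')
      simp [this]

theorem expect_pure (a : α) (f : α → ℝ) : expect (PMF.pure a) f = f a := by
  rw [expect_eq_sum _ f (s := {a}) (by simp)]
  simp

theorem expect_bind (hp : p.support.Finite) {q : α → PMF β}
    (hq : ∀ a, (q a).support.Finite) (f : β → ℝ) :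
    expect (p.bind q) f = expect p fun a => expect (q a) f := by
  classical
  set s := hp.toFinset with hs
  set t := s.biUnion fun a => (hq a).toFinset with ht
  have hqt : ∀ a ∈ s, (q a).support ⊆ t := fun a ha b hb =>
    Finset.mem_coe.2 (Finset.mem_biUnion.2 ⟨a, ha, (hq a).mem_toFinset.2 hb⟩)
  have hbt : (p.bind q).support ⊆ t := by
    intro b hb
    obtain ⟨a, ha, hab⟩ := (PMF.mem_support_bind_iff _ _ _).1 hb
    exact hqt a (hp.mem_toFinset.2 ha) hab
  rw [expect_eq_sum _ f hbt, expect_eq_sum p _ (s := s) (by simp [hs])]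
  have h1 : ∀ b, ((p.bind q) b).toReal = ∑ a ∈ s, (p a).toReal * (q a b).toReal := fun b => by
    have : (p.bind q) b = ∑ a ∈ s, p a * q a b := by
      rw [PMF.bind_apply]
      refine tsum_eq_sum fun a ha => ?_
      have : p a = 0 := by_contra fun h => ha (hp.mem_toFinset.2 ((p.mem_support_iff a).2 h))
      simp [this]
    rw [this, ENNReal.toReal_sum fun a _ =>
      ENNReal.mul_ne_top (p.apply_ne_top a) ((q a).apply_ne_top b)]
    simp only [ENNReal.toReal_mul]
  simp only [h1, Finset.sum_mul]
  rw [Finset.sum_comm]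
  refine Finset.sum_congr rfl fun a ha => ?_
  rw [expect_eq_sum _ f (hqt a ha), Finset.mul_sum]
  exact Finset.sum_congr rfl fun b _ => by ring

theorem expect_map (hp : p.support.Finite) (φ : α → β) (f : β → ℝ) :
    expect (p.map φ) f = expect p fun a => f (φ a) := by
  unfold PMF.map
  rw [expect_bind hp fun a => by simp]
  simp only [Function.comp, expect_pure]

/-- Jensen's inequality for the square root. -/
theorem expect_sqrt_le (hp : p.support.Finite) {f : α → ℝ} (hf : ∀ a, 0 ≤ f a) {M : ℝ} (hM : 0 < M)
    (h : expect p f ≤ M) : expect p (fun a => √(f a)) ≤ √M := by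
  have hs := Real.sqrt_pos.2 hM
  have hM2 : √M ^ 2 = M := Real.sq_sqrt hM.le
  -- The tangent of the square root at `M`.
  have h1 : ∀ a, √(f a) ≤ (2 * √M)⁻¹ * f a + √M / 2 := fun a => by
    have h2 : √(f a) ^ 2 = f a := Real.sq_sqrt (hf a)
    have h3 : (2 * √M)⁻¹ * f a + √M / 2 = (f a + √M ^ 2) / (2 * √M) := by field_simp
    rw [h3, le_div_iff₀ (by positivity)]
    nlinarith [sq_nonneg (√(f a) - √M)]
  calc expect p (fun a => √(f a)) ≤ expect p (fun a => (2 * √M)⁻¹ * f a + √M / 2) :=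
        expect_mono hp fun a _ => h1 a
    _ = (2 * √M)⁻¹ * expect p f + √M / 2 := by
        rw [expect_add hp, expect_const_mul, expect_const hp]
    _ ≤ (2 * √M)⁻¹ * M + √M / 2 := by gcongr
    _ = √M := by
        nth_rewrite 2 [← hM2]
        field_simp
        norm_num

end Expectation

/-! ### Unbiasedness, size and second moment of the sparsified quantization. -/

section EncodingMoments

theorem expect_coin {q : ℝ} (h0 : 0 ≤ q) (h1 : q ≤ 1) (f : Bool → ℝ) :
    expect (coin q) f = q * f true + (1 - q) * f false := by
  rw [expect_fintype, Fintype.sum_bool]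
  simp [coin, ENNReal.toReal_ofReal, h0, h1]

theorem expect_uniformOfFintype {α : Type*} [Fintype α] [Nonempty α] (f : α → ℝ) :
    expect (PMF.uniformOfFintype α) f = (Fintype.card α : ℝ)⁻¹ * ∑ a, f a := by
  rw [expect_fintype, Finset.mul_sum]
  simp

section Iid

variable {α : Type*} [Fintype α] (q : PMF α)

theorem expect_iidDraws_succ (m : ℕ) (F : (Fin (m + 1) → α) → ℝ) :
    expect (iidDraws q (m + 1)) F =
      expect q fun a => expect (iidDraws q m) fun c => F (Fin.cons a c) := by
  simp only [expect_fintype]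
  rw [← (Fin.consEquiv fun _ : Fin (m + 1) => α).sum_comp, Fintype.sum_prod_type]
  refine Finset.sum_congr rfl fun a _ => ?_
  rw [Finset.mul_sum]
  refine Finset.sum_congr rfl fun c _ => ?_
  simp [iidDraws, Fin.consEquiv, Fin.prod_univ_succ, mul_assoc]

theorem expect_iidDraws_sum (m : ℕ) (φ : α → ℝ) :
    expect (iidDraws q m) (fun c => ∑ j, φ (c j)) = m * expect q φ := by
  induction m with
  | zero => simp [expect]
  | succ m ih =>
    rw [expect_iidDraws_succ]
    simp only [Fin.sum_univ_succ, Fin.cons_zero, Fin.cons_succ]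
    simp only [expect_add (Set.toFinite _), expect_const (Set.toFinite _), ih]
    push_cast
    ring

/-- The `m` diagonal pairs give second moments; the `m ^ 2 - m` others factor by independence. -/
theorem expect_iidDraws_sum_sq (m : ℕ) (φ : α → ℝ) :
    expect (iidDraws q m) (fun c => (∑ j, φ (c j)) ^ 2) =
      m * expect q (fun a => φ a ^ 2) + (m ^ 2 - m) * expect q φ ^ 2 := by
  induction m with
  | zero => simp [expect]
  | succ m ih =>
    rw [expect_iidDraws_succ]
    simp only [Fin.sum_univ_succ, Fin.cons_zero, Fin.cons_succ]
    have : ∀ a, expect (iidDraws q m) (fun c => (φ a + ∑ j, φ (c j)) ^ 2) =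
        φ a ^ 2 + φ a * (2 * (m * expect q φ)) +
          (m * expect q (fun a => φ a ^ 2) + (m ^ 2 - m) * expect q φ ^ 2) := fun a => by
      rw [← ih, ← expect_iidDraws_sum, ← expect_const_mul, ← expect_const_mul,
        ← expect_const (p := iidDraws q m) (Set.toFinite _) (φ a ^ 2),
        ← expect_add (Set.toFinite _), ← expect_add (Set.toFinite _)]
      congr 1
      funext c
      ring
    simp only [this, expect_add (Set.toFinite _), expect_const (Set.toFinite _), expect_mul_const]
    push_cast
    ring

end Iid

/-- The rounding probability is genuine, so the clipping in `coin` is inactive. At `|y| = G` the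
truncated digit leaves exactly `1`. -/
theorem digits_le_and_le {p : ℕ} {G y : ℝ} (hG : 0 < G) (hy : |y| ≤ G) :
    0 ≤ 2 ^ p * |y| / G - ((digits p G y : ℕ) : ℝ) ∧
      2 ^ p * |y| / G - ((digits p G y : ℕ) : ℝ) ≤ 1 := by
  set r := 2 ^ p * |y| / G with hr
  have hr0 : 0 ≤ r := by positivity
  have hr1 : r ≤ 2 ^ p := by
    rw [hr, div_le_iff₀ hG]
    gcongr
  have hfl := Nat.floor_le hr0
  have hfl2 := Nat.lt_floor_add_one r
  have e : ((digits p G y : ℕ)) = min ⌊r⌋₊ (2 ^ p - 1) := rfl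
  rw [e]
  rcases le_total ⌊r⌋₊ (2 ^ p - 1) with h | h
  · rw [min_eq_left h]
    exact ⟨by linarith, by linarith⟩
  · rw [min_eq_right h]
    have h1 : ((2 ^ p - 1 : ℕ) : ℝ) = 2 ^ p - 1 := by
      have : 1 ≤ 2 ^ p := Nat.one_le_two_pow
      push_cast [this]
      rfl
    have h2 : ((2 ^ p - 1 : ℕ) : ℝ) ≤ ⌊r⌋₊ := by exact_mod_cast h
    rw [h1] at h2 ⊢
    exact ⟨by linarith, by linarith⟩

theorem expect_quantize {p : ℕ} {G y : ℝ} (hG : 0 < G) (hy : |y| ≤ G) (f : QuantCode p → ℝ) :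
    expect (quantize p G y) f =
      (2 ^ p * |y| / G - ((digits p G y : ℕ) : ℝ)) * f (decide (y < 0), digits p G y, true) +
      (1 - (2 ^ p * |y| / G - ((digits p G y : ℕ) : ℝ))) *
        f (decide (y < 0), digits p G y, false) := by
  obtain ⟨h0, h1⟩ := digits_le_and_le (p := p) hG hy
  rw [quantize, expect_map (Set.toFinite _), expect_coin h0 h1]

theorem expect_dequantize {p : ℕ} {G y : ℝ} (hG : 0 < G) (hy : |y| ≤ G) :
    expect (quantize p G y) (dequantize G) = y := by
  rw [expect_quantize hG hy]
  have h2 : (2 : ℝ) ^ p ≠ 0 := by positivity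
  by_cases hy0 : y < 0
  · simp only [dequantize, hy0, decide_true, if_true, abs_of_neg hy0, Bool.false_eq_true, if_false]
    field_simp
    ring
  · simp only [dequantize, hy0, decide_false, if_true, abs_of_nonneg (not_lt.1 hy0),
      Bool.false_eq_true, if_false]
    field_simp
    ring

/-- Rounding adds the Bernoulli variance `b (1 - b) ≤ 1`, in units of the squared mesh `G / 2 ^ p`.
-/
theorem expect_dequantize_sq_le {p : ℕ} {G y : ℝ} (hG : 0 < G) (hy : |y| ≤ G) :
    expect (quantize p G y) (fun q => dequantize G q ^ 2) ≤ y ^ 2 + (G / 2 ^ p) ^ 2 := by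
  obtain ⟨h0, h1⟩ := digits_le_and_le (p := p) hG hy
  rw [expect_quantize hG hy]
  set n : ℝ := ((digits p G y : ℕ) : ℝ) with hn
  set b := 2 ^ p * |y| / G - n with hb
  have hs : (if decide (y < 0) then (-1 : ℝ) else 1) ^ 2 = 1 := by split_ifs <;> norm_num
  have hyb : y ^ 2 = (G / 2 ^ p) ^ 2 * (n + b) ^ 2 := by
    rw [hb, ← sq_abs]
    field_simp
    ring
  simp only [dequantize, mul_pow, hs, if_true, Bool.false_eq_true, if_false, ← hn]
  rw [hyb]
  have h3 : 0 ≤ (G / 2 ^ p) ^ 2 * (1 - b + b ^ 2) := by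
    have : 0 ≤ 1 - b + b ^ 2 := by nlinarith
    positivity
  nlinarith

theorem abs_dequantize_le {p : ℕ} {G : ℝ} (hG : 0 < G) (q : QuantCode p) :
    |dequantize G q| ≤ G := by
  have hs : |if q.1 then (-1 : ℝ) else 1| = 1 := by split_ifs <;> simp
  have hq : (((q.2.1 : ℕ) : ℝ) + if q.2.2 then 1 else 0) ≤ 2 ^ p := by
    have h1 : ((q.2.1 : ℕ) : ℝ) + 1 ≤ 2 ^ p := by
      have : (q.2.1 : ℕ) + 1 ≤ 2 ^ p := q.2.1.2
      exact_mod_cast this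
    split_ifs <;> linarith
  have hq0 : 0 ≤ (((q.2.1 : ℕ) : ℝ) + if q.2.2 then 1 else 0) := by positivity
  rw [dequantize, abs_mul, abs_mul, hs, one_mul, abs_of_nonneg hq0, abs_of_pos (by positivity)]
  calc G / 2 ^ p * _ ≤ G / 2 ^ p * 2 ^ p := by gcongr
    _ = G := by field_simp

variable {d m p : ℕ} {G : ℝ}

/-- This holds for every code word, whatever its probability, so the bound `B = 2 d G` of the
algorithm is valid on all histories. -/
theorem norm_decode_le (hG : 0 < G) (c : Code d m p) : ‖decode G c‖ ≤ d * G := by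
  rw [decode, norm_smul, norm_inv, Real.norm_natCast]
  have h1 : ‖∑ j, EuclideanSpace.single (c j).1 ((d : ℝ) * dequantize G (c j).2)‖ ≤
      m * (d * G) := by
    refine (norm_sum_le _ _).trans ?_
    refine (Finset.sum_le_card_nsmul _ _ (d * G) fun j _ => ?_).trans (by simp)
    rw [PiLp.norm_single, norm_mul, Real.norm_natCast, Real.norm_eq_abs]
    gcongr
    exact abs_dequantize_le hG _
  rcases m.eq_zero_or_pos with h | h
  · subst h
    simp
    positivity
  · rw [inv_mul_le_iff₀ (by positivity)]
    exact h1

theorem abs_apply_le_norm (x : EuclideanSpace ℝ (Fin d)) (i : Fin d) : |x i| ≤ ‖x‖ := by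
  simpa using PiLp.norm_apply_le x i

variable [NeZero d] {x : EuclideanSpace ℝ (Fin d)}

theorem expect_singleDraw (φ : Fin d × QuantCode p → ℝ) :
    expect ((PMF.uniformOfFintype (Fin d)).bind
      (fun i => (quantize p G (x i)).map (fun q => (i, q)))) φ =
      (d : ℝ)⁻¹ * ∑ i, expect (quantize p G (x i)) fun q => φ (i, q) := by
  rw [expect_bind (Set.toFinite _) fun _ => Set.toFinite _, expect_uniformOfFintype]
  simp [expect_map (Set.toFinite _)]

/-- The decoded vector is unbiased. -/
theorem expect_inner_decode (hG : 0 < G) (hm : 0 < m) (hx : ‖x‖ ≤ G)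
    (w : EuclideanSpace ℝ (Fin d)) :
    expect (encode d m p G x) (fun c => inner ℝ (decode G c) w) = inner ℝ x w := by
  have hd : (d : ℝ) ≠ 0 := by exact_mod_cast NeZero.ne d
  have hm' : (m : ℝ) ≠ 0 := by exact_mod_cast hm.ne'
  set φ : Fin d × QuantCode p → ℝ := fun iq => (m : ℝ)⁻¹ * (d * w iq.1) * dequantize G iq.2 with hφ
  have h1 : ∀ c : Code d m p, inner ℝ (decode G c) w = ∑ j, φ (c j) :=
    fun c => by
      rw [decode, real_inner_smul_left, sum_inner, Finset.mul_sum]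
      refine Finset.sum_congr rfl fun j _ => ?_
      rw [EuclideanSpace.inner_single_left]
      simp [hφ]
      ring
  simp only [h1]
  rw [encode, expect_iidDraws_sum, expect_singleDraw]
  simp only [hφ, expect_const_mul]
  rw [PiLp.inner_apply, Finset.mul_sum, Finset.mul_sum]
  refine Finset.sum_congr rfl fun i _ => ?_
  have := expect_dequantize (p := p) hG ((abs_apply_le_norm x i).trans hx)
  change (m : ℝ) * ((d : ℝ)⁻¹ * ((m : ℝ)⁻¹ * (d * w i) * expect (quantize p G (x i)) (dequantize G)))
    = _
  rw [this]
  simp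
  field_simp

/-- The second moment of the decoded vector. -/
theorem expect_norm_sq_decode_le (hG : 0 < G) (hm : 0 < m) (hp : d ≤ 2 ^ p) (hx : ‖x‖ ≤ G) :
    expect (encode d m p G x) (fun c => ‖decode G c‖ ^ 2) ≤ G ^ 2 * (1 + 2 * d / m) := by
  have hd1 : (1 : ℝ) ≤ d := by exact_mod_cast NeZero.one_le
  have hm0 : (0 : ℝ) < m := by exact_mod_cast hm
  have hm1 : (1 : ℝ) ≤ m := by exact_mod_cast hm
  -- The contribution of one draw to coordinate `r`; each coordinate of the decoded vector is then a
  -- sum of independent draws.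
  set ψ : Fin d → Fin d × QuantCode p → ℝ := fun r iq =>
    if iq.1 = r then (m : ℝ)⁻¹ * d * dequantize G iq.2 else 0 with hψ
  have h1 : ∀ c : Code d m p, ‖decode G c‖ ^ 2 = ∑ r, (∑ j, ψ r (c j)) ^ 2 := fun c => by
    rw [EuclideanSpace.real_norm_sq_eq]
    refine Finset.sum_congr rfl fun r _ => ?_
    congr 1
    simp only [decode, PiLp.smul_apply, WithLp.ofLp_sum, Finset.sum_apply, smul_eq_mul,
      Finset.mul_sum, hψ]
    refine Finset.sum_congr rfl fun j _ => ?_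
    by_cases h : (c j).1 = r
    · simp [h, mul_assoc]
    · simp [h, Ne.symm h]
  have hxi : ∀ i, |x i| ≤ G := fun i => (abs_apply_le_norm x i).trans hx
  have hE1 : ∀ r, expect ((PMF.uniformOfFintype (Fin d)).bind
      (fun i => (quantize p G (x i)).map (fun q => (i, q)))) (ψ r) = (m : ℝ)⁻¹ * x r := fun r => by
    rw [expect_singleDraw, Finset.sum_eq_single r]
    · simp only [hψ, if_true, expect_const_mul]
      have := expect_dequantize (p := p) hG (hxi r)
      change (d : ℝ)⁻¹ * ((m : ℝ)⁻¹ * d * expect (quantize p G (x r)) (dequantize G)) = _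
      rw [this]
      field_simp
    · intro i _ hi
      simp [hψ, hi, expect]
    · simp
  have hE2 : ∀ r, expect ((PMF.uniformOfFintype (Fin d)).bind
      (fun i => (quantize p G (x i)).map (fun q => (i, q)))) (fun iq => ψ r iq ^ 2) ≤
      (m : ℝ)⁻¹ ^ 2 * d * (x r ^ 2 + (G / 2 ^ p) ^ 2) := fun r => by
    rw [expect_singleDraw, Finset.sum_eq_single r]
    · simp only [hψ, if_true, mul_pow, expect_const_mul]
      have := expect_dequantize_sq_le (p := p) hG (hxi r)
      calc (d : ℝ)⁻¹ * ((m : ℝ)⁻¹ ^ 2 * d ^ 2 *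
            expect (quantize p G (x r)) (fun q => dequantize G q ^ 2))
          ≤ (d : ℝ)⁻¹ * ((m : ℝ)⁻¹ ^ 2 * d ^ 2 * (x r ^ 2 + (G / 2 ^ p) ^ 2)) := by gcongr
        _ = _ := by field_simp
    · intro i _ hi
      simp [hψ, hi, expect]
    · simp
  simp only [h1]
  rw [expect_sum (Set.toFinite _)]
  have h2 : ∀ r, expect (encode d m p G x) (fun c => (∑ j, ψ r (c j)) ^ 2) ≤
      (d / m : ℝ) * (x r ^ 2 + (G / 2 ^ p) ^ 2) + x r ^ 2 := fun r => by
    rw [encode, expect_iidDraws_sum_sq, hE1]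
    have h3 := mul_le_mul_of_nonneg_left (hE2 r) hm0.le
    have e1 : (m : ℝ) * ((m : ℝ)⁻¹ ^ 2 * d * (x r ^ 2 + (G / 2 ^ p) ^ 2)) =
      (d / m : ℝ) * (x r ^ 2 + (G / 2 ^ p) ^ 2) := by field_simp
    have h4 : ((m : ℝ) ^ 2 - m) * ((m : ℝ)⁻¹ * x r) ^ 2 ≤ x r ^ 2 := by
      have e2 : ((m : ℝ) ^ 2 - m) * ((m : ℝ)⁻¹ * x r) ^ 2 = x r ^ 2 - (m : ℝ)⁻¹ * x r ^ 2 := by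
        field_simp
      have : 0 ≤ (m : ℝ)⁻¹ * x r ^ 2 := by positivity
      linarith
    linarith
  refine (Finset.sum_le_sum fun r _ => h2 r).trans ?_
  have hxn : ∑ r, x r ^ 2 ≤ G ^ 2 := by
    rw [← EuclideanSpace.real_norm_sq_eq]
    gcongr
  -- With `d ≤ 2 ^ p`, the quantization noise summed over all coordinates stays below `G ^ 2`.
  have hdp : (d : ℝ) * (G / 2 ^ p) ^ 2 ≤ G ^ 2 := by
    have h5 : (d : ℝ) ≤ 2 ^ p := by exact_mod_cast hp
    have h6 : (d : ℝ) ≤ (2 ^ p) ^ 2 := by nlinarith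
    rw [div_pow, mul_div_assoc', div_le_iff₀ (by positivity)]
    nlinarith [sq_nonneg G]
  rw [Finset.sum_add_distrib, ← Finset.mul_sum, Finset.sum_add_distrib, Finset.sum_const,
    Finset.card_univ, Fintype.card_fin, nsmul_eq_mul]
  calc (d / m : ℝ) * (∑ r, x r ^ 2 + d * (G / 2 ^ p) ^ 2) + ∑ r, x r ^ 2
      ≤ (d / m : ℝ) * (G ^ 2 + G ^ 2) + G ^ 2 := by gcongr
    _ = _ := by ring

end EncodingMoments

/-! ### Estimates and predictions along a history. -/

section Predictions

variable {V : Type*} {d k : ℕ} {G : ℝ} {adv : Adversary V d k}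

theorem estimates_append_of_lt {h : List (Word d k)} {t : ℕ} (ht : t < h.length) (c : Word d k) :
    estimates G (h ++ [c]) t = estimates G h t := by
  simp [estimates, List.getElem?_append_left ht]

theorem estimates_append_length (h : List (Word d k)) (c : Word d k) :
    estimates G (h ++ [c]) h.length = decode G c := by
  simp [estimates]

theorem norm_estimates_le (hG : 0 < G) (h : List (Word d k)) (s : ℕ) :
    ‖estimates G h s‖ ≤ d * G := by
  unfold estimates
  cases h[s]? with
  | none => simp; positivity
  | some c => exact norm_decode_le hG c

variable [Fintype V] [DecidableEq V] (Gr : SimpleGraph V) [DecidableRel Gr.Adj]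

/-- Along a history, all predictions are those of one run of the black-box reduction. -/
theorem prediction_take {ν : ℝ} (h : List (Word d k)) {t : ℕ} (ht : t ≤ h.length) :
    prediction Gr G ν adv (h.take t) =
      blackBox (adaDelayDist Gr.diam (2 * d * G) (available Gr (adv.activations h)))
        (scaleAlg Gr.diam (2 * d * G) 0 ν (available Gr (adv.activations h)))
        (estimates G h) t := by
  unfold prediction
  rw [List.length_take, min_eq_left ht]
  refine blackBox_congr (fun s => available_subset_range Gr _ s) (fun s hs => ?_) fun s hs => ?_
  · refine available_congr Gr fun r hr => ?_
    simp only [Adversary.activations, List.take_take, min_eq_left (hr.trans hs)]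
  · simp only [estimates, List.getElem?_take, hs, if_true]

end Predictions

/-! ### Conditioning on the history of code words. -/

section Histories

variable {V : Type*} {d k : ℕ} [NeZero d] {G : ℝ} {adv : Adversary V d k}

theorem support_history_finite (t : ℕ) : (history G adv t).support.Finite := by
  induction t with
  | zero => simp [history]
  | succ t ih =>
    rw [history, PMF.support_bind]
    exact ih.biUnion fun _ _ => by
      rw [PMF.support_map]
      exact (Set.toFinite _).image _

theorem length_of_mem_support_history {t : ℕ} {h : List (Word d k)}
    (hh : h ∈ (history G adv t).support) : h.length = t := by
  induction t generalizing h with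
  | zero => simpa [history] using hh
  | succ t ih =>
    rw [history, PMF.mem_support_bind_iff] at hh
    obtain ⟨h', hh', hc⟩ := hh
    rw [PMF.mem_support_map_iff] at hc
    obtain ⟨c, -, rfl⟩ := hc
    simp [ih hh']

theorem expect_history_succ (t : ℕ) (f : List (Word d k) → ℝ) :
    expect (history G adv (t + 1)) f = expect (history G adv t) fun h =>
      expect (encode d (repetitions d k) (precision d) G (adv.grad h)) fun c => f (h ++ [c]) := by
  rw [history, expect_bind (support_history_finite t) fun _ => by
    rw [PMF.support_map]
    exact (Set.toFinite _).image _]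
  simp only [expect_map (Set.toFinite _)]

/-- The gradients can be replaced by their unbiased estimates. -/
theorem expect_sum_inner_grad (hG : 0 < G) (hm : 0 < repetitions d k) {T : ℕ}
    (hgrad : ∀ h : List (Word d k), h.length < T → ‖adv.grad h‖ ≤ G)
    (X : List (Word d k) → EuclideanSpace ℝ (Fin d)) :
    expect (history G adv T)
        (fun h => ∑ t ∈ Finset.range T, inner ℝ (adv.grad (h.take t)) (X (h.take t))) =
      expect (history G adv T)
        (fun h => ∑ t ∈ Finset.range T, inner ℝ (estimates G h t) (X (h.take t))) := by
  induction T with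
  | zero => simp
  | succ T ih =>
    have hf := support_history_finite (G := G) (adv := adv) T
    rw [expect_history_succ, expect_history_succ]
    have h1 : ∀ h ∈ (history G adv T).support,
        expect (encode d (repetitions d k) (precision d) G (adv.grad h))
          (fun c => ∑ t ∈ Finset.range (T + 1),
            inner ℝ (adv.grad ((h ++ [c]).take t)) (X ((h ++ [c]).take t))) =
        ∑ t ∈ Finset.range T, inner ℝ (adv.grad (h.take t)) (X (h.take t)) +
          inner ℝ (adv.grad h) (X h) := fun h hh => by
      have hl := length_of_mem_support_history hh
      have e : ∀ c : Word d k, ∑ t ∈ Finset.range (T + 1),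
          inner ℝ (adv.grad ((h ++ [c]).take t)) (X ((h ++ [c]).take t)) =
          ∑ t ∈ Finset.range T, inner ℝ (adv.grad (h.take t)) (X (h.take t)) +
            inner ℝ (adv.grad h) (X h) := fun c => by
        rw [Finset.sum_range_succ, ← hl, List.take_left]
        congr 1
        refine Finset.sum_congr rfl fun t ht => ?_
        rw [List.take_append_of_le_length (Finset.mem_range.1 ht).le]
      simp only [e, expect_const (Set.toFinite _)]
    have h2 : ∀ h ∈ (history G adv T).support,
        expect (encode d (repetitions d k) (precision d) G (adv.grad h))
          (fun c => ∑ t ∈ Finset.range (T + 1),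
            inner ℝ (estimates G (h ++ [c]) t) (X ((h ++ [c]).take t))) =
        ∑ t ∈ Finset.range T, inner ℝ (estimates G h t) (X (h.take t)) +
          inner ℝ (adv.grad h) (X h) := fun h hh => by
      have hl := length_of_mem_support_history hh
      have e : ∀ c : Word d k, ∑ t ∈ Finset.range (T + 1),
          inner ℝ (estimates G (h ++ [c]) t) (X ((h ++ [c]).take t)) =
          ∑ t ∈ Finset.range T, inner ℝ (estimates G h t) (X (h.take t)) +
            inner ℝ (decode G c) (X h) := fun c => by
        rw [Finset.sum_range_succ, ← hl, List.take_left, estimates_append_length]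
        congr 1
        refine Finset.sum_congr rfl fun t ht => ?_
        rw [List.take_append_of_le_length (Finset.mem_range.1 ht).le,
          estimates_append_of_lt (Finset.mem_range.1 ht)]
      simp only [e]
      -- Given `h`, the gradient and `X h` are fixed and only the last code word is random, so
      -- unbiasedness applies even to an adaptive adversary.
      rw [expect_add (Set.toFinite _), expect_const (Set.toFinite _),
        expect_inner_decode hG hm (hgrad h (by omega))]
    rw [expect_congr _ h1, expect_congr _ h2, expect_add hf, expect_add hf,
      ih fun h hh => hgrad h (by omega)]

theorem expect_sum_norm_sq_estimates_le (hG : 0 < G) (hm : 0 < repetitions d k) {T : ℕ}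
    (hgrad : ∀ h : List (Word d k), h.length < T → ‖adv.grad h‖ ≤ G) :
    expect (history G adv T) (fun h => ∑ t ∈ Finset.range T, ‖estimates G h t‖ ^ 2) ≤
      T * (G ^ 2 * (1 + 2 * d / repetitions d k)) := by
  induction T with
  | zero => simp [expect]
  | succ T ih =>
    have hf := support_history_finite (G := G) (adv := adv) T
    rw [expect_history_succ]
    have h2 : ∀ h ∈ (history G adv T).support,
        expect (encode d (repetitions d k) (precision d) G (adv.grad h))
          (fun c => ∑ t ∈ Finset.range (T + 1), ‖estimates G (h ++ [c]) t‖ ^ 2) ≤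
        ∑ t ∈ Finset.range T, ‖estimates G h t‖ ^ 2 +
          G ^ 2 * (1 + 2 * d / repetitions d k) := fun h hh => by
      have hl := length_of_mem_support_history hh
      have e : ∀ c : Word d k, ∑ t ∈ Finset.range (T + 1), ‖estimates G (h ++ [c]) t‖ ^ 2 =
          ∑ t ∈ Finset.range T, ‖estimates G h t‖ ^ 2 + ‖decode G c‖ ^ 2 := fun c => by
        rw [Finset.sum_range_succ, ← hl, estimates_append_length]
        congr 1
        exact Finset.sum_congr rfl fun t ht => by
          rw [estimates_append_of_lt (Finset.mem_range.1 ht)]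
      simp only [e]
      rw [expect_add (Set.toFinite _), expect_const (Set.toFinite _)]
      have := expect_norm_sq_decode_le (p := precision d) hG hm (Nat.le_pow_clog one_lt_two d)
        (hgrad h (by omega))
      linarith
    refine (expect_mono hf h2).trans ?_
    rw [expect_add hf, expect_const hf]
    have := ih fun h hh => hgrad h (by omega)
    push_cast
    linarith

end Histories

/-! ### The number of repetitions in terms of the bandwidth. -/

section Budget

theorem clog_two_le {d : ℕ} (hd : 0 < d) : (Nat.clog 2 d : ℝ) ≤ 1 + 2 * Real.log d := by
  have hd1 : (1 : ℝ) ≤ d := by exact_mod_cast hd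
  have hlog := Real.log_nonneg hd1
  rcases Nat.lt_or_ge 1 d with h | h
  · have h1 : 2 ^ (Nat.clog 2 d - 1) < d := Nat.pow_pred_clog_lt_self one_lt_two h
    have h2 : ((2 : ℝ) ^ (Nat.clog 2 d - 1)) ≤ d := by exact_mod_cast h1.le
    have h3 := Real.log_le_log (by positivity) h2
    rw [Real.log_pow] at h3
    have h4 : (Nat.clog 2 d : ℝ) ≤ ((Nat.clog 2 d - 1 : ℕ) : ℝ) + 1 := by
      have : Nat.clog 2 d ≤ Nat.clog 2 d - 1 + 1 := by omega
      exact_mod_cast this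
    have h5 : (0 : ℝ) ≤ ((Nat.clog 2 d - 1 : ℕ) : ℝ) := Nat.cast_nonneg _
    have := Real.log_two_gt_d9
    nlinarith
  · rw [Nat.clog_of_right_le_one h]
    push_cast
    linarith

/-- The variance factor of the encoding in terms of the bandwidth. -/
theorem one_add_two_mul_div_repetitions_le {d b D : ℕ} (hd : 0 < d) (hD : 0 < D)
    (hk : 3 * Nat.clog 2 d + 2 ≤ b / D) :
    (1 + 2 * d / repetitions d (b / D) : ℝ) ≤ 48 * ((1 + Real.log d) * (1 + d * D / b)) := by
  set m := repetitions d (b / D) with hm_def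
  set w := 3 * Nat.clog 2 d + 2 with hw
  have hm : 0 < m := Nat.div_pos hk (by omega)
  have hlog : 0 ≤ Real.log d := Real.log_nonneg (by exact_mod_cast hd)
  have h1 : b / D < w * (m + 1) := Nat.lt_mul_div_succ _ (by omega)
  have h2 : b < D * (b / D + 1) := Nat.lt_mul_div_succ _ hD
  -- Both floors lose only a bounded factor, because `w` and `m` are at least `1`.
  have h3 : b ≤ D * (4 * (w * m)) := by
    have h4 : b / D + 1 ≤ 4 * (w * m) := by
      have : w ≤ w * m := Nat.le_mul_of_pos_right _ hm
      have : 1 ≤ w := by omega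
      nlinarith
    exact h2.le.trans (Nat.mul_le_mul_left D h4)
  have hb : 0 < b := by
    by_contra h
    have : b = 0 := by omega
    rw [this, Nat.zero_div] at hk
    omega
  have hb' : (0 : ℝ) < b := by exact_mod_cast hb
  have hm' : (0 : ℝ) < m := by exact_mod_cast hm
  have h3' : (b : ℝ) ≤ D * (4 * (w * m)) := by exact_mod_cast h3
  have hwr : (w : ℝ) ≤ 6 * (1 + Real.log d) := by
    have := clog_two_le hd
    rw [hw]
    push_cast
    linarith
  have h5 : (2 * d / m : ℝ) ≤ 8 * w * (d * D / b) := by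
    rw [mul_div_assoc', div_le_div_iff₀ hm' hb']
    have : (0 : ℝ) ≤ d := Nat.cast_nonneg _
    nlinarith
  have h6 : (0 : ℝ) ≤ d * D / b := by positivity
  have h7 := mul_le_mul_of_nonneg_right hwr h6
  nlinarith [mul_nonneg hlog h6]

end Budget

/-! ### Assembly of the regret bounds. -/

section Main

/-- Division by zero yields `0` in `ℕ`, so the bit budget itself rules out a zero diameter. -/
theorem diam_pos_of_budget {V : Type*} {Gr : SimpleGraph V} {d b : ℕ}
    (hk : 3 * Nat.clog 2 d + 2 ≤ b / Gr.diam) : 0 < Gr.diam := by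
  by_contra h
  have : Gr.diam = 0 := by omega
  rw [this, Nat.div_zero] at hk
  omega

theorem one_le_logFactor {d D T : ℕ} {G ν U : ℝ} (hG : 0 < G) (hν : 0 < ν) (hU : 0 ≤ U) :
    1 ≤ logFactor d D T G ν U := by
  have : 0 ≤ U * (1 + d * D * G * T) / ν := by positivity
  have := Real.log_nonneg (by linarith : 1 ≤ 1 + U * (1 + d * D * G * T) / ν)
  unfold logFactor
  linarith

variable {V : Type*} [Fintype V] [DecidableEq V] {Gr : SimpleGraph V} [DecidableRel Gr.Adj]
  {d : ℕ} [NeZero d] {b : ℕ} {G ν : ℝ} {T : ℕ} {adv : Adversary V d (b / Gr.diam)}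

/-- The lag of the estimated gradients along a history. -/
noncomputable def historyLag (Gr : SimpleGraph V) [DecidableRel Gr.Adj] (G : ℝ)
    (adv : Adversary V d (b / Gr.diam)) (T : ℕ) (h : List (Word d (b / Gr.diam))) : ℝ :=
  lag (available Gr (adv.activations h)) (fun s => ‖estimates G h s‖) T

theorem boundedDelay_available (hc : Gr.Connected) (hD : 0 < Gr.diam) (I : ℕ → V) :
    BoundedDelay Gr.diam (available Gr I) :=
  ⟨hD, available_subset_range Gr I, fun _ _ h => mem_available_of_diam_le Gr I hc hD h⟩

theorem sum_inner_estimates_le (hc : Gr.Connected) (hD : 0 < Gr.diam) (hG : 0 < G) (hν : 0 < ν)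
    (hT : 0 < T) (u : EuclideanSpace ℝ (Fin d)) {h : List (Word d (b / Gr.diam))}
    (hl : h.length = T) :
    ∑ t ∈ Finset.range T,
      inner ℝ (estimates G h t) (prediction Gr G ν adv (h.take t) - u) ≤
      ν + ‖u‖ * (12 * (√(1 + historyLag Gr G adv T h) * √(logFactor d Gr.diam T G ν ‖u‖)) +
        10602 * (d * Gr.diam * G * logFactor d Gr.diam T G ν ‖u‖)) := by
  have hd1 : (1 : ℝ) ≤ d := by exact_mod_cast NeZero.one_le
  have hD1 : (1 : ℝ) ≤ Gr.diam := by exact_mod_cast hD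
  have hT1 : (1 : ℝ) ≤ T := by exact_mod_cast hT
  set S := available Gr (adv.activations h) with hS_def
  have hS : BoundedDelay Gr.diam S := boundedDelay_available hc hD _
  have hdG : 0 < (d : ℝ) * G := by positivity
  have hB : 0 < 2 * (d : ℝ) * G := by positivity
  have hg : ∀ s, ‖estimates G h s‖ ≤ 2 * d * G := fun s => by
    have := norm_estimates_le hG h s
    linarith
  -- Large enough to dominate both the inverse of the largest learning rate and the crude lag bound,
  -- it becomes the argument of the logarithm.
  set K : ℝ := 1 + d * Gr.diam * G * T with hK_def
  have hK : 1 ≤ K := by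
    have : 0 ≤ d * Gr.diam * G * T := by positivity
    linarith
  have hdDG : (d * G : ℝ) * 1 ≤ d * G * Gr.diam := by gcongr
  have hdDGT : (d * G * Gr.diam : ℝ) * 1 ≤ d * G * Gr.diam * T := by gcongr
  have hBK : 2 * d * G * 20 * (1 + 2 * Gr.diam) ≤ 120 * K := by
    rw [hK_def]
    nlinarith
  have hΛK : lag S (fun s => ‖estimates G h s‖) T ≤ K * (2 * d * G * 20 * (1 + 2 * Gr.diam)) := by
    refine (hS.lag_le (fun s => norm_nonneg _) (norm_estimates_le hG h) T).trans ?_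
    have h1 : (T : ℝ) * ((2 * Gr.diam - 1) * (d * G) ^ 2) ≤
        (d * Gr.diam * G * T) * (d * G * 40) := by
      have h2 : (2 * Gr.diam - 1 : ℝ) ≤ 40 * Gr.diam := by linarith
      have h3 : 0 ≤ T * (d * G : ℝ) ^ 2 := by positivity
      nlinarith
    have h2 : (d * G * 40 : ℝ) ≤ 2 * d * G * 20 * (1 + 2 * Gr.diam) := by nlinarith
    refine h1.trans ?_
    gcongr
    linarith
  have key := hS.blackBox_regret hB hν hg u hK hBK T hΛK
  have e : ∀ t ∈ Finset.range T,
      inner ℝ (estimates G h t) (prediction Gr G ν adv (h.take t) - u) =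
      inner ℝ (estimates G h t) (blackBox (adaDelayDist Gr.diam (2 * d * G) S)
        (scaleAlg Gr.diam (2 * d * G) 0 ν S) (estimates G h) t - u) := fun t ht => by
    rw [prediction_take Gr h (by rw [hl]; exact (Finset.mem_range.1 ht).le)]
  rw [Finset.sum_congr rfl e]
  refine key.trans ?_
  have hL := one_le_logFactor (d := d) (D := Gr.diam) (T := T) hG hν (norm_nonneg u)
  have eL : 1 + Real.log (1 + ‖u‖ * K / ν) = logFactor d Gr.diam T G ν ‖u‖ := rfl
  have hΛ0 : 0 ≤ lag S (fun s => ‖estimates G h s‖) T := lag_nonneg (fun s => norm_nonneg _) T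
  rw [eL, Real.sqrt_mul (by linarith)]
  have h4 : 1767 * (2 * d * G * (1 + 2 * Gr.diam)) * logFactor d Gr.diam T G ν ‖u‖ ≤
      10602 * (d * Gr.diam * G * logFactor d Gr.diam T G ν ‖u‖) := by
    have : 2 * d * G * (1 + 2 * (Gr.diam : ℝ)) ≤ 6 * (d * Gr.diam * G) := by nlinarith
    have := mul_le_mul_of_nonneg_right this (by linarith : 0 ≤ logFactor d Gr.diam T G ν ‖u‖)
    linarith
  have h5 : historyLag Gr G adv T h = lag S (fun s => ‖estimates G h s‖) T := rfl
  rw [h5]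
  gcongr

theorem expect_sqrt_historyLag_le (hc : Gr.Connected) (hG : 0 < G)
    (hk : 3 * Nat.clog 2 d + 2 ≤ b / Gr.diam) (hadv : adv.Admissible Gr G ν T) :
    expect (history G adv T) (fun h => √(1 + historyLag Gr G adv T h)) ≤
      10 * (1 + G * √((1 + Real.log d) * (1 + d * Gr.diam / b) * Gr.diam * T)) := by
  have hD := diam_pos_of_budget hk
  have hd : 0 < d := Nat.pos_of_ne_zero (NeZero.ne d)
  have hf := support_history_finite (G := G) (adv := adv) T
  have hm : 0 < repetitions d (b / Gr.diam) := Nat.div_pos hk (by omega)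
  have hlog : 0 ≤ Real.log d := Real.log_nonneg (by exact_mod_cast hd)
  set X := (1 + Real.log d) * (1 + d * Gr.diam / b) * Gr.diam * T with hX
  have hX0 : 0 ≤ X := by positivity
  have h1 : expect (history G adv T) (fun h => 1 + historyLag Gr G adv T h) ≤
      1 + 96 * (G ^ 2 * X) := by
    have h2 : ∀ h ∈ (history G adv T).support, 1 + historyLag Gr G adv T h ≤
        1 + 2 * Gr.diam * ∑ t ∈ Finset.range T, ‖estimates G h t‖ ^ 2 := fun h _ => by
      have := (boundedDelay_available hc hD (adv.activations h)).lag_le_sum_sq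
        (fun s => ‖estimates G h s‖) T
      unfold historyLag
      linarith
    refine (expect_mono hf h2).trans ?_
    rw [expect_add hf, expect_const hf, expect_const_mul]
    have h3 := expect_sum_norm_sq_estimates_le (adv := adv) (T := T) hG hm
      fun h hh => (hadv h hh).2.2
    have h4 := one_add_two_mul_div_repetitions_le hd hD hk
    calc (1 : ℝ) + 2 * Gr.diam * expect (history G adv T)
          (fun h => ∑ t ∈ Finset.range T, ‖estimates G h t‖ ^ 2)
        ≤ 1 + 2 * Gr.diam * (T * (G ^ 2 * (1 + 2 * d / repetitions d (b / Gr.diam)))) := by gcongr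
      _ ≤ 1 + 2 * Gr.diam * (T * (G ^ 2 * (48 * ((1 + Real.log d) * (1 + d * Gr.diam / b))))) := by
          gcongr
      _ = _ := by rw [hX]; ring
  refine (expect_sqrt_le hf (fun h => ?_) (by positivity) h1).trans ?_
  · have : 0 ≤ historyLag Gr G adv T h := lag_nonneg (fun s => norm_nonneg _) T
    linarith
  -- `96 = 2 * 48` is below `10 ^ 2`.
  · rw [Real.sqrt_le_left (by positivity)]
    have h2 : √X ^ 2 = X := Real.sq_sqrt hX0
    have h3 : 0 ≤ G * √X := by positivity
    have h4 : G ^ 2 * X = (G * √X) ^ 2 := by rw [mul_pow, h2]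
    rw [h4]
    nlinarith

theorem expectedRegret_le (hc : Gr.Connected) (hG : 0 < G) (hν : 0 < ν)
    (hk : 3 * Nat.clog 2 d + 2 ≤ b / Gr.diam) (hadv : adv.Admissible Gr G ν T)
    (u : EuclideanSpace ℝ (Fin d)) :
    expectedRegret Gr G ν adv T u ≤ ν + ‖u‖ * (10602 *
      ((1 + G * √((1 + Real.log d) * (1 + d * Gr.diam / b) * Gr.diam * T)) *
          √(logFactor d Gr.diam T G ν ‖u‖) +
        d * Gr.diam * G * logFactor d Gr.diam T G ν ‖u‖)) := by
  have hL := one_le_logFactor (d := d) (D := Gr.diam) (T := T) hG hν (norm_nonneg u)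
  have hsq := Real.sqrt_nonneg (logFactor d Gr.diam T G ν ‖u‖)
  set L := logFactor d Gr.diam T G ν ‖u‖ with hL_def
  set X := (1 + Real.log d) * (1 + d * Gr.diam / b) * Gr.diam * T with hX
  have hf := support_history_finite (G := G) (adv := adv) T
  have hD := diam_pos_of_budget hk
  change expect (history G adv T) (regret Gr G ν adv T u) ≤ _
  -- The pathwise bound needs `1 ≤ T`, since `K` must dominate `d D G`.
  rcases T.eq_zero_or_pos with hT | hT
  · have h0 : expect (history G adv T) (regret Gr G ν adv T u) = 0 := by
      subst hT
      simp [expect, regret]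
    rw [h0]
    positivity
  · have hm : 0 < repetitions d (b / Gr.diam) := Nat.div_pos hk (by omega)
    calc expect (history G adv T) (regret Gr G ν adv T u)
        ≤ expect (history G adv T) (fun h => ∑ t ∈ Finset.range T,
            inner ℝ (adv.grad (h.take t)) (prediction Gr G ν adv (h.take t) - u)) := by
          refine expect_mono hf fun h hh => Finset.sum_le_sum fun t ht => ?_
          have hl := length_of_mem_support_history hh
          have ht' := Finset.mem_range.1 ht
          have h1 := (hadv (h.take t) (by rw [List.length_take]; omega)).2.1 u
          rw [← neg_sub u, inner_neg_right]
          linarith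
      _ = expect (history G adv T) (fun h => ∑ t ∈ Finset.range T,
            inner ℝ (estimates G h t) (prediction Gr G ν adv (h.take t) - u)) :=
          expect_sum_inner_grad hG hm (fun h hh => (hadv h hh).2.2)
            fun h => prediction Gr G ν adv h - u
      _ ≤ expect (history G adv T) (fun h => (ν + ‖u‖ * (10602 * (d * Gr.diam * G * L))) +
            ‖u‖ * 12 * √L * √(1 + historyLag Gr G adv T h)) := by
          refine expect_mono hf fun h hh => ?_
          have := sum_inner_estimates_le (adv := adv) hc hD hG hν hT u
            (length_of_mem_support_history hh)
          rw [← hL_def] at this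
          linarith
      _ = (ν + ‖u‖ * (10602 * (d * Gr.diam * G * L))) + ‖u‖ * 12 * √L *
            expect (history G adv T) (fun h => √(1 + historyLag Gr G adv T h)) := by
          rw [expect_add hf, expect_const hf, expect_const_mul]
      _ ≤ (ν + ‖u‖ * (10602 * (d * Gr.diam * G * L))) + ‖u‖ * 12 * √L *
            (10 * (1 + G * √X)) := by
          gcongr
          exact expect_sqrt_historyLag_le hc hG hk hadv
      _ ≤ _ := by
          have : 0 ≤ ‖u‖ * √L * (1 + G * √X) := by positivity
          linarith

/-- The lower-order terms are dominated when the horizon is large. -/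
theorem bound_of_large_horizon {d D T b : ℕ} {L : ℝ} (hd : 0 < d) (hG : 0 < G) (hD : 0 < D)
    (hL : 1 ≤ L) (hT : (d : ℝ) ^ 2 * D ≤ T) (hGT : 1 ≤ G ^ 2 * T) :
    (1 + G * √((1 + Real.log d) * (1 + d * D / b) * D * T)) * √L + d * D * G * L ≤
      3 * ((G * √((1 + d * D / b) * D * T)) * (√(1 + Real.log d) * L)) := by
  have hlog : 0 ≤ Real.log d := Real.log_nonneg (by exact_mod_cast hd)
  have hD1 : (1 : ℝ) ≤ D := by exact_mod_cast hD
  set X := (1 + d * D / b : ℝ) * D * T with hX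
  have hDT : (D : ℝ) * T ≤ X := by
    have : 0 ≤ (d * D / b : ℝ) * D * T := by positivity
    rw [hX]
    nlinarith
  have hX0 : 0 ≤ X := by positivity
  have e : (1 + Real.log d) * (1 + d * D / b) * D * T = (1 + Real.log d) * X := by rw [hX]; ring
  rw [e, Real.sqrt_mul (by positivity)]
  set q := √(1 + Real.log d) with hq
  have hq1 : 1 ≤ q := Real.one_le_sqrt.2 (by linarith)
  have hLs : √L ≤ L := Real.sqrt_le_iff.2 ⟨by linarith, by nlinarith⟩
  -- Here `1 ≤ G ^ 2 * T` absorbs the additive `1`; next, `d ^ 2 * D ≤ T` gives `(d * D) ^ 2 ≤ D * T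
  -- ≤ X`, absorbing the term linear in `L`.
  have h1 : 1 ≤ G * √X := by
    rw [← Real.sqrt_sq hG.le, ← Real.sqrt_mul (sq_nonneg G)]
    refine Real.one_le_sqrt.2 (hGT.trans ?_)
    gcongr
    have : (0 : ℝ) ≤ T := Nat.cast_nonneg _
    nlinarith
  have h2 : (d * D : ℝ) ≤ √X := by
    refine Real.le_sqrt_of_sq_le ?_
    have := mul_le_mul_of_nonneg_left hT (by linarith : (0 : ℝ) ≤ D)
    nlinarith
  have h3 : G * √X ≤ G * (q * √X) := by
    have : √X * 1 ≤ √X * q := by gcongr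
    rw [mul_comm q]
    gcongr
    linarith
  have h4 : (1 + G * (q * √X)) * √L ≤ (2 * (G * (q * √X))) * L := by
    gcongr
    linarith
  have h5 : d * D * G * L ≤ G * (q * √X) * L := by
    have := mul_le_mul_of_nonneg_left h2 hG.le
    exact mul_le_mul_of_nonneg_right (by linarith) (by linarith)
  linarith

end Main

end DOCO

open DOCO in
theorem mainTheorem7 :
    ∃ C : ℝ, 0 < C ∧
      ∀ (V : Type*) [Fintype V] [DecidableEq V] (Gr : SimpleGraph V) [DecidableRel Gr.Adj]
        (d : ℕ) [NeZero d] (b : ℕ) (G ν : ℝ) (T : ℕ) (adv : Adversary V d (b / Gr.diam)),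
        Gr.Connected → 0 < G → 0 < ν →
        3 * Nat.clog 2 d + 2 ≤ b / Gr.diam →
        adv.Admissible Gr G ν T →
        -- a code word fits in `k = ⌊b / D⌋` bits
        Nonempty (Word d (b / Gr.diam) ↪ (Fin (b / Gr.diam) → Bool)) ∧
        -- every message fits in `b` bits
        (∀ (h : List (Word d (b / Gr.diam))) (t : ℕ) (n : V),
          (message Gr (adv.activations h) t n).card * (b / Gr.diam) ≤ b) ∧
        ∀ u : EuclideanSpace ℝ (Fin d),
          -- the bound with explicit lower-order terms, for every horizon
          expectedRegret Gr G ν adv T u ≤ ν + ‖u‖ * (C *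
            ((1 + G * √((1 + Real.log d) * (1 + d * Gr.diam / b) * Gr.diam * T)) *
                √(logFactor d Gr.diam T G ν ‖u‖) +
              d * Gr.diam * G * logFactor d Gr.diam T G ν ‖u‖)) ∧
          -- the bound up to logarithmic factors, as soon as the horizon is large enough
          ((d : ℝ) ^ 2 * Gr.diam ≤ T → 1 ≤ G ^ 2 * T →
            expectedRegret Gr G ν adv T u ≤ ν + ‖u‖ * (C *
              (G * √((1 + d * Gr.diam / b) * Gr.diam * T)) *
                (√(1 + Real.log d) * logFactor d Gr.diam T G ν ‖u‖))) := by
  -- `31806 = 3 * 10602`, the `3` coming from `bound_of_large_horizon`.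
  refine ⟨31806, by norm_num, fun V _ _ Gr _ d _ b G ν T adv hc hG hν hk hadv =>
    ⟨nonempty_word_embedding d _, fun h t n => ?_, fun u => ?_⟩⟩
  · calc (message Gr (adv.activations h) t n).card * (b / Gr.diam)
        ≤ Gr.diam * (b / Gr.diam) := Nat.mul_le_mul_right _ (message_card_le Gr _ t n)
      _ ≤ b := Nat.mul_div_le _ _
  · have hL := one_le_logFactor (d := d) (D := Gr.diam) (T := T) hG hν (norm_nonneg u)
    have hd : 0 < d := Nat.pos_of_ne_zero (NeZero.ne d)
    have key := expectedRegret_le hc hG hν hk hadv u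
    refine ⟨key.trans ?_, fun hT hGT => key.trans ?_⟩
    · gcongr
      norm_num
    · have h := bound_of_large_horizon (b := b) hd hG (diam_pos_of_budget hk) hL hT hGT
      rw [add_le_add_iff_left]
      refine mul_le_mul_of_nonneg_left ?_ (norm_nonneg u)
      linarith
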